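/- Let $\mathfrak W=\mathrm{Der}_{\mathbb C}\,\mathbb C[x]$ be the Lie algebra of vector fields on the line, with basis $d_i=x^{i+1}\frac{d}{dx}$, $i\ge -1$, and let $\mathfrak W^+=\mathrm{span}\{d_i : i\ge 1\}$. For a left $U(\mathfrak W)$-module $M$ and $\mu\in\mathbb C$ put $M_\mu=\{v\in M : d_0v=\mu v\}$. Let $\mathcal O$ be the full subcategory of the category of left $U(\mathfrak W)$-modules whose objects $M$ are finitely generated over $U(\mathfrak W)$, satisfy $M=\bigoplus_{\mu\in\mathbb C}M_\mu$, and are locally $\mathfrak W^+$-finite, i.e. $\dim_{\mathbb C} U(\mathfrak W^+)v<\infty$ for every $v\in M$. For $\lambda\in\mathbb C$ let $\mathcal O_{[\lambda]}$ be the full subcategory of those $M\in\mathcal O$ all of whose weights (the $\mu$ with $M_\mu\neq 0$) lie in $\lambda+\mathbb Z$; it is a $\mathbb C$-linear abelian category. A $\mathbb C$-linear abelian category $\mathcal C$ is called wild if there is an exact ($\mathbb C$-linear) functor, from the category of finite-dimensional representations of the free associative algebra $\mathbb C\langle x_1,x_2\rangle$ to $\mathcal C$, which preserves indecomposability and takes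 non-isomorphic objects to non-isomorphic objects. Theorem. For every $\lambda\in\mathbb C$, the block $\mathcal O_{[\lambda]}$ is wild. -/

import Mathlib

open CategoryTheory CategoryTheory.Limits Polynomial
open scoped ModuleCat

universe v u

noncomputable section

namespace VectorFields

/-! ## The Lie algebra of vector fields on the line -/

/-- The Witt algebra of rank one: the Lie algebra of derivations of `ℂ[x]`. -/
abbrev WittAlgebra : Type := Derivation ℂ ℂ[X] ℂ[X]

/-- `vf n` is the vector field `x ^ n * d/dx`; thus `vf 0 = d₋₁`, `vf 1 = d₀`, and in general
`vf (i + 1) = dᵢ` for the usual basis `dᵢ = x ^ (i + 1) * d/dx`, `i ≥ -1`. -/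
def vf (n : ℕ) : WittAlgebra := (X ^ n : ℂ[X]) • derivative'

/-- The universal enveloping algebra of the Witt algebra. -/
abbrev UW : Type := UniversalEnvelopingAlgebra ℂ WittAlgebra

/-- The image of `vf n` in the universal enveloping algebra. -/
def uvf (n : ℕ) : UW := UniversalEnvelopingAlgebra.ι ℂ (vf n)

/-- The subalgebra `U(W⁺)` of `U(W)`, generated by `W⁺ = span {d₁, d₂, …}`. -/
def UWplus : Subalgebra ℂ UW := Algebra.adjoin ℂ (Set.range fun n : ℕ => uvf (n + 2))

section Modules

variable (M : Type v) [AddCommGroup M] [Module ℂ M] [Module UW M] [IsScalarTower ℂ UW M]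

/-- The weight space `M_μ = {v ∈ M | d₀ v = μ v}`. -/
def weightSpace (μ : ℂ) : Submodule ℂ M where
  carrier := {w | uvf 1 • w = μ • w}
  add_mem' {a b} ha hb := by
    simp only [Set.mem_ofPred_eq] at ha hb ⊢
    rw [smul_add, smul_add, ha, hb]
  zero_mem' := by simp
  smul_mem' c w hw := by
    have : SMulCommClass ℂ UW M := IsScalarTower.to_smulCommClass
    simp only [Set.mem_ofPred_eq] at hw ⊢
    rw [← smul_comm c (uvf 1) w, hw, smul_comm]

/-- The subspace `U(W⁺) w` of `M`. -/
def orbitPlus (w : M) : Submodule ℂ M :=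
  (Subalgebra.toSubmodule UWplus).map ((LinearMap.toSpanSingleton UW M w).restrictScalars ℂ)

/-- The axioms of the category `𝒪` for the Witt algebra. -/
structure IsInO : Prop where
  /-- `M` is finitely generated over `U(W)`. -/
  fg : Module.Finite UW M
  /-- `M` is a weight module: it is the (automatically direct) sum of its weight spaces. -/
  weight : ⨆ μ : ℂ, weightSpace M μ = ⊤
  /-- `M` is locally `W⁺`-finite. -/
  locallyFinite : ∀ w : M, FiniteDimensional ℂ (orbitPlus M w)

/-- The set of weights of `M`. -/
def Supp : Set ℂ := {μ | weightSpace M μ ≠ ⊥}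

end Modules

/-- The category `𝒪`, as a property of left `U(W)`-modules. -/
def categoryO : ObjectProperty (ModuleCat.{0} UW) := fun M => IsInO M

/-- The block `𝒪_[lam]`: the modules in `𝒪` whose weights all lie in the coset `lam + ℤ`. -/
def blockO (lam : ℂ) : ObjectProperty (ModuleCat.{0} UW) := fun M =>
  categoryO M ∧ ∀ μ ∈ Supp M, ∃ n : ℤ, μ = lam + n

/-! ## Closure properties: the block is an abelian category -/

section Closure

variable {M N N' : Type v} [AddCommGroup M] [Module ℂ M] [Module UW M] [IsScalarTower ℂ UW M]
  [AddCommGroup N] [Module ℂ N] [Module UW N] [IsScalarTower ℂ UW N]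
  [AddCommGroup N'] [Module ℂ N'] [Module UW N'] [IsScalarTower ℂ UW N']

theorem mem_weightSpace {μ : ℂ} {w : M} : w ∈ weightSpace M μ ↔ uvf 1 • w = μ • w := Iff.rfl

theorem mem_orbitPlus {w x : M} : x ∈ orbitPlus M w ↔ ∃ a ∈ UWplus, a • w = x := by
  simp [orbitPlus]

theorem weightSpace_iSupIndep : iSupIndep (weightSpace M) := by
  have : SMulCommClass UW ℂ M := IsScalarTower.to_smulCommClass'
  have h := Module.End.eigenspaces_iSupIndep (Algebra.lsmul ℂ ℂ M (uvf 1))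
  have e : (Algebra.lsmul ℂ ℂ M (uvf 1)).eigenspace = weightSpace M := by
    funext μ
    ext w
    rw [Module.End.mem_eigenspace_iff, mem_weightSpace]
    simp
  rwa [e] at h

theorem map_mem_weightSpace (f : N →ₗ[UW] M) {μ : ℂ} {w : N} (hw : w ∈ weightSpace N μ) :
    f w ∈ weightSpace M μ := by
  rw [mem_weightSpace] at hw ⊢
  rw [← map_smul, hw, f.map_smul_of_tower]

theorem orbitPlus_map (f : N →ₗ[UW] M) (w : N) :
    orbitPlus M (f w) = (orbitPlus N w).map (f.restrictScalars ℂ) := by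
  ext x
  simp [mem_orbitPlus]

theorem orbitPlus_add_le (w x : M) : orbitPlus M (w + x) ≤ orbitPlus M w ⊔ orbitPlus M x := by
  intro y hy
  obtain ⟨a, ha, rfl⟩ := mem_orbitPlus.1 hy
  rw [smul_add]
  exact Submodule.add_mem_sup (mem_orbitPlus.2 ⟨a, ha, rfl⟩) (mem_orbitPlus.2 ⟨a, ha, rfl⟩)

theorem isInO_of_maps (f : N →ₗ[UW] M) (g : N' →ₗ[UW] M) (h : f.range ⊔ g.range = ⊤)
    (hN : IsInO N) (hN' : IsInO N') : IsInO M := by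
  have hx : ∀ x : M, ∃ a b, f a + g b = x := by
    intro x
    have : x ∈ f.range ⊔ g.range := h ▸ Submodule.mem_top
    obtain ⟨_, ⟨a, rfl⟩, _, ⟨b, rfl⟩, e⟩ := Submodule.mem_sup.1 this
    exact ⟨a, b, e⟩
  refine ⟨?_, ?_, ?_⟩
  · have := hN.fg
    have := hN'.fg
    exact ⟨h ▸ (Submodule.FG.sup (LinearMap.range_eq_map f ▸ Module.Finite.fg_top.map f)
      (LinearMap.range_eq_map g ▸ Module.Finite.fg_top.map g))⟩
  · have key : ∀ {K : Type v} [AddCommGroup K] [Module ℂ K] [Module UW K] [IsScalarTower ℂ UW K]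
        (k : K →ₗ[UW] M), IsInO K → ∀ a, k a ∈ ⨆ μ : ℂ, weightSpace M μ := by
      intro K _ _ _ _ k hK a
      have ha : a ∈ ⨆ μ : ℂ, weightSpace K μ := hK.weight ▸ Submodule.mem_top
      refine (iSup_le (a := (⨆ μ : ℂ, weightSpace M μ).comap (k.restrictScalars ℂ)) ?_) ha
      intro μ w hw
      exact Submodule.mem_iSup_of_mem μ (map_mem_weightSpace k hw)
    rw [eq_top_iff]
    intro x _
    obtain ⟨a, b, rfl⟩ := hx x
    exact add_mem (key f hN a) (key g hN' b)
  · intro x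
    obtain ⟨a, b, rfl⟩ := hx x
    have := hN.locallyFinite a
    have := hN'.locallyFinite b
    refine Submodule.finiteDimensional_of_le (orbitPlus_add_le _ _ |>.trans_eq ?_)
      (S₂ := (orbitPlus N a).map (f.restrictScalars ℂ) ⊔
        (orbitPlus N' b).map (g.restrictScalars ℂ))
    rw [orbitPlus_map, orbitPlus_map]

/-- Submodules of weight modules are weight modules. -/
theorem iSup_weightSpace_of_injective (f : N →ₗ[UW] M) (hf : Function.Injective f)
    (hM : ⨆ μ : ℂ, weightSpace M μ = ⊤) : ⨆ μ : ℂ, weightSpace N μ = ⊤ := by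
  classical
  rw [eq_top_iff]
  intro x _
  have hx : f x ∈ ⨆ μ : ℂ, weightSpace M μ := hM ▸ Submodule.mem_top
  obtain ⟨c, hc⟩ := (Submodule.mem_iSup_iff_exists_dfinsupp' _ _).1 hx
  have hq : ∀ μ, (c μ : M) ∈ f.range := by
    let q := f.range.mkQ
    let c' : Π₀ μ : ℂ, weightSpace (M ⧸ f.range) μ :=
      c.mapRange (fun μ (w : weightSpace M μ) => ⟨q (w : M), map_mem_weightSpace q w.2⟩)
        (fun μ => by ext; simp)
    have h0 : c' = 0 := by
      apply weightSpace_iSupIndep.dfinsupp_lsum_injective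
      rw [map_zero, DFinsupp.lsum_apply_apply, DFinsupp.sumAddHom_apply]
      have : (c'.sum fun μ w => (w : M ⧸ f.range)) = q (c.sum fun μ w => (w : M)) := by
        rw [DFinsupp.sum_mapRange_index (by simp)]
        simp only [DFinsupp.sum, map_sum]
      refine this.trans ?_
      rw [hc]
      exact (Submodule.Quotient.mk_eq_zero _).2 ⟨x, rfl⟩
    intro μ
    have := congrArg (fun z => ((z μ : weightSpace (M ⧸ f.range) μ) : M ⧸ f.range)) h0
    exact (Submodule.Quotient.mk_eq_zero _).1 (by simpa [c', q] using this)
  choose n hn using hq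
  have hxn : x = ∑ μ ∈ c.support, n μ := by
    apply hf
    rw [← hc, map_sum]
    simp only [hn, DFinsupp.sum]
  rw [hxn]
  refine Submodule.sum_mem _ fun μ _ => Submodule.mem_iSup_of_mem μ ?_
  rw [mem_weightSpace]
  apply hf
  rw [map_smul, f.map_smul_of_tower, hn]
  exact (c μ).2

theorem bracket_vf (m n : ℕ) :
    ⁅vf m, vf n⁆ = ((n : ℂ) - m) • vf (m + n - 1) := by
  apply Polynomial.derivation_ext
  rw [Derivation.commutator_apply]
  simp only [vf, Derivation.smul_apply, smul_eq_mul, derivative'_apply, derivative_X, mul_one,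
    derivative_X_pow]
  rcases m with _ | m <;> rcases n with _ | n
  · simp
  · simp [Polynomial.smul_eq_C_mul]
  · simp [Polynomial.smul_eq_C_mul]
    ring
  · have e : m + 1 + (n + 1) - 1 = m + n + 1 := by omega
    rw [e]
    simp only [Nat.add_sub_cancel, Polynomial.smul_eq_C_mul, map_sub]
    ring

theorem span_vf : Submodule.span ℂ (Set.range vf) = ⊤ := by
  rw [eq_top_iff]
  intro D _
  have hD : D = mkDerivation ℂ (D X) := Polynomial.derivation_ext (by simp)
  have h : ∀ p : ℂ[X], mkDerivation ℂ p ∈ Submodule.span ℂ (Set.range vf) := by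
    intro p
    induction p using Polynomial.induction_on' with
    | add p q hp hq => rw [map_add]; exact add_mem hp hq
    | monomial n a =>
      have : (mkDerivation ℂ (monomial n a) : WittAlgebra) = a • vf n := by
        apply Polynomial.derivation_ext
        simp [vf, Polynomial.smul_eq_C_mul, Polynomial.C_mul_X_pow_eq_monomial]
      rw [this]
      exact Submodule.smul_mem _ _ (Submodule.subset_span ⟨n, rfl⟩)
  rw [hD]
  exact h _

attribute [local instance] LieRing.ofAssociativeRing

theorem uvf_comm (m n : ℕ) :
    uvf m * uvf n = uvf n * uvf m + ((n : ℂ) - m) • uvf (m + n - 1) := by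
  have h := congrArg (UniversalEnvelopingAlgebra.ι ℂ) (bracket_vf m n)
  rw [LieHom.map_lie, map_smul, LieRing.of_associative_ring_bracket] at h
  rw [uvf, uvf, uvf, ← h]
  abel

theorem adjoin_uvf : Algebra.adjoin ℂ (Set.range uvf) = ⊤ := by
  set S := Algebra.adjoin ℂ (Set.range uvf) with hS
  have hmem : ∀ D, UniversalEnvelopingAlgebra.ι ℂ D ∈ S := by
    intro D
    have hD : D ∈ Submodule.span ℂ (Set.range vf) := span_vf ▸ Submodule.mem_top
    induction hD using Submodule.span_induction with
    | mem x hx =>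
      obtain ⟨n, rfl⟩ := hx
      exact Algebra.subset_adjoin ⟨n, rfl⟩
    | zero => simp
    | add x y _ _ hx hy => rw [map_add]; exact add_mem hx hy
    | smul c x _ hx => rw [map_smul]; exact Subalgebra.smul_mem _ hx c
  let g : WittAlgebra →ₗ⁅ℂ⁆ S :=
    { toFun := fun D => ⟨UniversalEnvelopingAlgebra.ι ℂ D, hmem D⟩
      map_add' := fun x y => by ext; simp
      map_smul' := fun c x => by ext; simp
      map_lie' := fun {x y} => by
        exact Subtype.ext (LieHom.map_lie _ x y) }
  have hid : S.val.comp (UniversalEnvelopingAlgebra.lift ℂ g) = AlgHom.id ℂ UW := by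
    apply UniversalEnvelopingAlgebra.hom_ext
    ext D : 1
    change ((UniversalEnvelopingAlgebra.lift ℂ g (UniversalEnvelopingAlgebra.ι ℂ D) : S) : UW) = _
    rw [UniversalEnvelopingAlgebra.lift_ι_apply]
    rfl
  rw [eq_top_iff]
  intro a _
  have := congrArg (fun φ : UW →ₐ[ℂ] UW => φ a) hid
  simp only [AlgHom.comp_apply, AlgHom.id_apply] at this
  rw [← this]
  exact Subtype.property _

theorem smul_mem_of_stable (K : Submodule ℂ M) (hK : ∀ n, ∀ x ∈ K, uvf n • x ∈ K) (a : UW) :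
    ∀ x ∈ K, a • x ∈ K := by
  have ha : a ∈ Algebra.adjoin ℂ (Set.range uvf) := adjoin_uvf ▸ Algebra.mem_top
  induction ha using Algebra.adjoin_induction with
  | mem x hx => obtain ⟨n, rfl⟩ := hx; exact hK n
  | algebraMap r => intro x hx; rw [algebraMap_smul]; exact K.smul_mem r hx
  | add a b _ _ ha hb => intro x hx; rw [add_smul]; exact add_mem (ha x hx) (hb x hx)
  | mul a b _ _ ha hb => intro x hx; rw [mul_smul]; exact ha _ (hb x hx)

theorem commutator_mem_UWplus {a : UW} (ha : a ∈ UWplus) :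
    uvf 1 * a - a * uvf 1 ∈ UWplus := by
  induction ha using Algebra.adjoin_induction with
  | mem x hx =>
    obtain ⟨n, rfl⟩ := hx
    dsimp only
    rw [uvf_comm 1 (n + 2), add_sub_cancel_left]
    have e : 1 + (n + 2) - 1 = n + 2 := by omega
    rw [e]
    exact Subalgebra.smul_mem _ (Algebra.subset_adjoin (Set.mem_range_self n)) _
  | algebraMap r =>
    rw [Algebra.commutes, sub_self]
    exact zero_mem _
  | add a b _ _ ha hb =>
    have : uvf 1 * (a + b) - (a + b) * uvf 1
        = (uvf 1 * a - a * uvf 1) + (uvf 1 * b - b * uvf 1) := by noncomm_ring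
    rw [this]
    exact add_mem ha hb
  | mul a b ha' hb' ha hb =>
    have : uvf 1 * (a * b) - a * b * uvf 1
        = (uvf 1 * a - a * uvf 1) * b + a * (uvf 1 * b - b * uvf 1) := by noncomm_ring
    rw [this]
    exact add_mem (mul_mem ha hb') (mul_mem ha' hb)

/-- A module in `𝒪` is generated over `U(W)` by a finite-dimensional subspace that is stable
under `d₀, d₁, …`. -/
theorem exists_generating_subspace (hM : IsInO M) : ∃ N₀ : Submodule ℂ M,
    FiniteDimensional ℂ N₀ ∧ Submodule.span UW (N₀ : Set M) = ⊤ ∧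
    ∀ n, ∀ x ∈ N₀, uvf (n + 1) • x ∈ N₀ := by
  classical
  obtain ⟨S, hS⟩ := hM.fg.fg_top
  have hw : ∀ x : M, ∃ T : Finset M, (∀ t ∈ T, ∃ μ : ℂ, t ∈ weightSpace M μ) ∧
      x ∈ Submodule.span ℂ (T : Set M) := by
    intro x
    have hx : x ∈ Submodule.span ℂ (⋃ μ : ℂ, (weightSpace M μ : Set M)) := by
      rw [← Submodule.iSup_eq_span, hM.weight]
      exact Submodule.mem_top
    obtain ⟨T, hT, hxT⟩ := Submodule.mem_span_finite_of_mem_span hx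
    exact ⟨T, fun t ht => Set.mem_iUnion.1 (hT ht), hxT⟩
  choose T hT hxT using hw
  let B : Finset M := S.biUnion T
  have hB : ∀ t ∈ B, ∃ μ : ℂ, t ∈ weightSpace M μ := by
    intro t ht
    obtain ⟨s, _, hs⟩ := Finset.mem_biUnion.1 ht
    exact hT s t hs
  refine ⟨⨆ t ∈ B, orbitPlus M t, ?_, ?_, ?_⟩
  · have := hM.locallyFinite
    exact Submodule.finiteDimensional_finset_sup B (fun t => orbitPlus M t) |> fun h => by
      rwa [Finset.sup_eq_iSup] at h
  · rw [eq_top_iff, ← hS, Submodule.span_le]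
    intro s hs
    have h1 : Submodule.span ℂ (T s : Set M) ≤
        (Submodule.span UW ((⨆ t ∈ B, orbitPlus M t : Submodule ℂ M) : Set M)).restrictScalars ℂ
        := by
      rw [Submodule.span_le]
      intro t ht
      apply Submodule.subset_span
      have htB : t ∈ B := Finset.mem_biUnion.2 ⟨s, hs, ht⟩
      exact (le_iSup₂_of_le (f := fun t (_ : t ∈ B) => orbitPlus M t) t htB le_rfl)
        (mem_orbitPlus.2 ⟨1, one_mem _, one_smul _ _⟩)
    exact h1 (hxT s)
  · intro n
    have hsm : SMulCommClass ℂ UW M := IsScalarTower.to_smulCommClass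
    let L : M →ₗ[ℂ] M :=
      { toFun := fun x => uvf (n + 1) • x
        map_add' := fun x y => smul_add _ _ _
        map_smul' := fun c x => (smul_comm c (uvf (n + 1)) x).symm }
    change (⨆ t ∈ B, orbitPlus M t) ≤ (⨆ t ∈ B, orbitPlus M t).comap L
    refine iSup₂_le fun t ht => ?_
    have hle : orbitPlus M t ≤ ⨆ t ∈ B, orbitPlus M t :=
      le_iSup₂_of_le (f := fun t (_ : t ∈ B) => orbitPlus M t) t ht le_rfl
    intro x hx
    apply hle
    change uvf (n + 1) • x ∈ orbitPlus M t
    obtain ⟨a, ha, rfl⟩ := mem_orbitPlus.1 hx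
    rcases n with _ | n
    · obtain ⟨μ, hμ⟩ := hB t ht
      have : uvf (0 + 1) • a • t = (uvf 1 * a - a * uvf 1) • t + μ • a • t := by
        rw [sub_smul, mul_smul, mul_smul, mem_weightSpace.1 hμ, smul_comm μ a t,
          sub_add_cancel]
      rw [this]
      exact add_mem (mem_orbitPlus.2 ⟨_, commutator_mem_UWplus ha, rfl⟩)
        (Submodule.smul_mem _ _ hx)
    · exact mem_orbitPlus.2 ⟨uvf (n + 2) * a,
        mul_mem (Algebra.subset_adjoin ⟨n, rfl⟩) ha, mul_smul _ _ _⟩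

/-- Modules in `𝒪` are Noetherian, because they are finitely generated over `ℂ[d₋₁]`. -/
theorem isNoetherian_of_isInO (hM : IsInO M) : IsNoetherian UW M := by
  obtain ⟨N₀, hfin, hgen, hst⟩ := exists_generating_subspace hM
  have hsm : SMulCommClass ℂ UW M := IsScalarTower.to_smulCommClass
  let K : Submodule ℂ M := Submodule.span ℂ {x | ∃ (p : ℕ) (w : M), w ∈ N₀ ∧ x = uvf 0 ^ p • w}
  have hbase : ∀ (p : ℕ) (w : M), w ∈ N₀ → uvf 0 ^ p • w ∈ K := fun p w hw =>
    Submodule.subset_span ⟨p, w, hw, rfl⟩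
  have h0 : ∀ x ∈ K, uvf 0 • x ∈ K := by
    intro x hx
    induction hx using Submodule.span_induction with
    | mem x hx =>
      obtain ⟨p, w, hw, rfl⟩ := hx
      rw [← mul_smul, ← pow_succ']
      exact hbase _ _ hw
    | zero => rw [smul_zero]; exact zero_mem _
    | add x y _ _ hx hy => rw [smul_add]; exact add_mem hx hy
    | smul c x _ hx => rw [smul_comm]; exact K.smul_mem c hx
  have hp : ∀ (p n : ℕ) (w : M), w ∈ N₀ → uvf n • uvf 0 ^ p • w ∈ K := by
    intro p
    induction p with
    | zero =>
      intro n w hw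
      rcases n with _ | n
      · exact h0 _ (hbase 0 w hw)
      · rw [pow_zero, one_smul]
        simpa using hbase 0 _ (hst n w hw)
    | succ p ih =>
      intro n w hw
      rw [pow_succ', mul_smul, ← mul_smul (uvf n), uvf_comm n 0, add_smul, mul_smul, smul_assoc]
      exact add_mem (h0 _ (ih n w hw)) (K.smul_mem _ (ih _ w hw))
  have hK : ∀ n, ∀ x ∈ K, uvf n • x ∈ K := by
    intro n x hx
    induction hx using Submodule.span_induction with
    | mem x hx =>
      obtain ⟨p, w, hw, rfl⟩ := hx
      exact hp p n w hw
    | zero => rw [smul_zero]; exact zero_mem _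
    | add x y _ _ hx hy => rw [smul_add]; exact add_mem hx hy
    | smul c x _ hx => rw [smul_comm]; exact K.smul_mem c hx
  have hKtop : ∀ x, x ∈ K := by
    intro x
    have hx : x ∈ Submodule.span UW (N₀ : Set M) := hgen ▸ Submodule.mem_top
    induction hx using Submodule.span_induction with
    | mem x hx => simpa using hbase 0 x hx
    | zero => exact zero_mem _
    | add x y _ _ hx hy => exact add_mem hx hy
    | smul a x _ hx => exact smul_mem_of_stable K hK a x hx
  let φ : ℂ[X] →ₐ[ℂ] UW := aeval (uvf 0)
  let _ : Module ℂ[X] M := Module.compHom M φ.toRingHom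
  have hφ : ∀ (p : ℂ[X]) (x : M), p • x = φ p • x := fun _ _ => rfl
  have hfinX : Module.Finite ℂ[X] M := by
    obtain ⟨B, hB⟩ := (Submodule.fg_iff_finiteDimensional N₀).2 hfin
    refine ⟨⟨B, ?_⟩⟩
    rw [eq_top_iff]
    intro x _
    have hC : ∀ (c : ℂ) (y : M), c • y = (C c : ℂ[X]) • y := by
      intro c y
      rw [hφ]
      simp [φ]
    have hN : ∀ w ∈ N₀, w ∈ Submodule.span ℂ[X] (B : Set M) := by
      intro w hw
      rw [← hB] at hw
      induction hw using Submodule.span_induction with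
      | mem x hx => exact Submodule.subset_span hx
      | zero => exact zero_mem _
      | add x y _ _ hx hy => exact add_mem hx hy
      | smul c x _ hx => rw [hC]; exact Submodule.smul_mem _ _ hx
    have hx := hKtop x
    induction hx using Submodule.span_induction with
    | mem x hx =>
      obtain ⟨p, w, hw, rfl⟩ := hx
      have : uvf 0 ^ p • w = (X ^ p : ℂ[X]) • w := by rw [hφ]; simp [φ]
      rw [this]
      exact Submodule.smul_mem _ _ (hN w hw)
    | zero => exact zero_mem _
    | add x y _ _ hx hy => exact add_mem (hx trivial) (hy trivial)
    | smul c x _ hx => rw [hC]; exact Submodule.smul_mem _ _ (hx trivial)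
  have hnX : IsNoetherian ℂ[X] M := inferInstance
  let r : Submodule UW M → Submodule ℂ[X] M := fun P =>
    { carrier := P
      add_mem' := P.add_mem
      zero_mem' := P.zero_mem
      smul_mem' := fun p x hx => P.smul_mem (φ p) hx }
  have hr : StrictMono r := fun P Q h => h
  rw [isNoetherian_iff'] at hnX ⊢
  exact hr.wellFoundedGT

theorem isInO_of_injective (f : N →ₗ[UW] M) (hf : Function.Injective f) (hM : IsInO M) :
    IsInO N := by
  refine ⟨?_, iSup_weightSpace_of_injective f hf hM.weight, ?_⟩
  · have := isNoetherian_of_isInO hM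
    have := isNoetherian_of_injective f hf
    infer_instance
  · intro w
    have h := hM.locallyFinite (f w)
    rw [orbitPlus_map] at h
    exact Module.Finite.equiv
      (Submodule.equivMapOfInjective (f.restrictScalars ℂ) hf (orbitPlus N w)).symm

theorem supp_of_injective (f : N →ₗ[UW] M) (hf : Function.Injective f) : Supp N ⊆ Supp M := by
  intro μ hμ
  obtain ⟨w, hw, hw0⟩ := Submodule.exists_mem_ne_zero_of_ne_bot hμ
  intro h
  have := map_mem_weightSpace f hw
  rw [h, Submodule.mem_bot] at this
  exact hw0 (hf (by rw [this, map_zero]))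

theorem supp_of_maps (f : N →ₗ[UW] M) (g : N' →ₗ[UW] M) (h : f.range ⊔ g.range = ⊤)
    (hN : IsInO N) (hN' : IsInO N') : Supp M ⊆ Supp N ∪ Supp N' := by
  intro μ hμ
  by_contra hcon
  simp only [Supp, Set.mem_union, Set.mem_ofPred_eq, not_or, not_not] at hcon
  have key : ∀ {K : Type v} [AddCommGroup K] [Module ℂ K] [Module UW K] [IsScalarTower ℂ UW K]
      (k : K →ₗ[UW] M), IsInO K → weightSpace K μ = ⊥ →
      ∀ a, k a ∈ ⨆ ν, ⨆ (_ : ν ≠ μ), weightSpace M ν := by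
    intro K _ _ _ _ k hK h0 a
    have ha : a ∈ ⨆ ν : ℂ, weightSpace K ν := hK.weight ▸ Submodule.mem_top
    refine (iSup_le (a := (⨆ ν, ⨆ (_ : ν ≠ μ), weightSpace M ν).comap
      (k.restrictScalars ℂ)) ?_) ha
    intro ν w hw
    by_cases hν : ν = μ
    · subst hν
      rw [h0, Submodule.mem_bot] at hw
      rw [hw]
      exact zero_mem _
    · exact Submodule.mem_iSup_of_mem ν (Submodule.mem_iSup_of_mem hν (map_mem_weightSpace k hw))
  have htop : ⨆ ν, ⨆ (_ : ν ≠ μ), weightSpace M ν = ⊤ := by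
    rw [eq_top_iff]
    intro x _
    have : x ∈ f.range ⊔ g.range := h ▸ Submodule.mem_top
    obtain ⟨_, ⟨a, rfl⟩, _, ⟨b, rfl⟩, e⟩ := Submodule.mem_sup.1 this
    rw [← e]
    exact add_mem (key f hN hcon.1 a) (key g hN' hcon.2 b)
  have hind := weightSpace_iSupIndep (M := M) μ
  rw [htop, disjoint_top] at hind
  exact hμ hind

end Closure

section Instances

theorem isInO_of_subsingleton (M : Type v) [AddCommGroup M] [Module ℂ M] [Module UW M]
    [IsScalarTower ℂ UW M] [Subsingleton M] : IsInO M :=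
  ⟨inferInstance, Subsingleton.elim _ _, fun _ => inferInstance⟩

variable (lam : ℂ)

theorem blockO_of_maps {A B Y : ModuleCat.{0} UW} (f : A ⟶ Y) (g : B ⟶ Y)
    (h : f.hom.range ⊔ g.hom.range = ⊤) (hA : blockO lam A) (hB : blockO lam B) :
    blockO lam Y := by
  refine ⟨isInO_of_maps f.hom g.hom h hA.1 hB.1, fun μ hμ => ?_⟩
  rcases supp_of_maps f.hom g.hom h hA.1 hB.1 hμ with h | h
  · exact hA.2 μ h
  · exact hB.2 μ h

instance : (blockO lam).ContainsZero where
  exists_zero := ⟨ModuleCat.of UW PUnit, ModuleCat.isZero_of_subsingleton _,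
    isInO_of_subsingleton _, fun _ hμ => (hμ (Subsingleton.elim _ _)).elim⟩

instance : (blockO lam).IsClosedUnderSubobjects where
  prop_of_mono f _ hY := by
    have hf := (ModuleCat.mono_iff_injective f).1 inferInstance
    exact ⟨isInO_of_injective f.hom hf hY.1, fun μ hμ => hY.2 μ (supp_of_injective f.hom hf hμ)⟩

instance : (blockO lam).IsClosedUnderQuotients where
  prop_of_epi f _ hX := by
    have hf := (ModuleCat.epi_iff_range_eq_top f).1 inferInstance
    exact blockO_of_maps lam f f (by rw [hf, sup_idem]) hX hX

theorem isClosedUnderFiniteProducts_of_biprod {C : Type u} [Category.{v} C] [Abelian C]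
    (P : ObjectProperty C) [P.ContainsZero] [P.IsClosedUnderIsomorphisms]
    (h : ∀ A B : C, P A → P B → P (A ⊞ B)) : P.IsClosedUnderFiniteProducts := by
  have : P.IsClosedUnderBinaryProducts :=
    ⟨by
      rintro X ⟨p⟩
      refine P.prop_of_iso ?_ (h _ _ (p.prop_diag_obj (.mk .left)) (p.prop_diag_obj (.mk .right)))
      exact IsLimit.conePointUniqueUpToIso (BinaryBiproduct.isLimit _ _)
        ((IsLimit.postcomposeHomEquiv (diagramIsoPair p.diag) _).2 p.isLimit)⟩
  exact .mk'

theorem range_inl_sup_range_inr {R : Type} [Ring R] (A B : ModuleCat.{0} R) :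
    (biprod.inl : A ⟶ A ⊞ B).hom.range ⊔ (biprod.inr : B ⟶ A ⊞ B).hom.range = ⊤ := by
  rw [eq_top_iff]
  intro x _
  have h := congrArg (fun k => k.hom x) (biprod.total (X := A) (Y := B))
  simp only [ModuleCat.hom_add, ModuleCat.hom_comp, ModuleCat.hom_id, LinearMap.add_apply,
    LinearMap.comp_apply, LinearMap.id_apply] at h
  rw [← h]
  exact Submodule.add_mem_sup ⟨_, rfl⟩ ⟨_, rfl⟩

instance : (blockO lam).IsClosedUnderFiniteProducts :=
  isClosedUnderFiniteProducts_of_biprod _ fun A B hA hB =>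
    blockO_of_maps lam biprod.inl biprod.inr (range_inl_sup_range_inr A B) hA hB

end Instances

/-! ## Wild representation type -/

/-- The free associative algebra `ℂ⟨x₁, x₂⟩`. -/
abbrev FreeAlg : Type := FreeAlgebra ℂ (Fin 2)

/-- The finite-dimensional representations of `ℂ⟨x₁, x₂⟩`. -/
def finDimRep : ObjectProperty (ModuleCat.{0} FreeAlg) := fun V => FiniteDimensional ℂ V

section FinDim

theorem finDimRep_of_maps {A B Y : ModuleCat.{0} FreeAlg} (f : A ⟶ Y) (g : B ⟶ Y)
    (h : f.hom.range ⊔ g.hom.range = ⊤) (hA : finDimRep A) (hB : finDimRep B) :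
    finDimRep Y := by
  have hA' : FiniteDimensional ℂ A := hA
  have hB' : FiniteDimensional ℂ B := hB
  let k : (A × B) →ₗ[ℂ] Y := (f.hom.restrictScalars ℂ).coprod (g.hom.restrictScalars ℂ)
  refine Module.Finite.of_surjective k fun x => ?_
  have : x ∈ f.hom.range ⊔ g.hom.range := h ▸ Submodule.mem_top
  obtain ⟨_, ⟨a, rfl⟩, _, ⟨b, rfl⟩, e⟩ := Submodule.mem_sup.1 this
  exact ⟨(a, b), e⟩

instance : finDimRep.ContainsZero where
  exists_zero := ⟨ModuleCat.of FreeAlg PUnit, ModuleCat.isZero_of_subsingleton _,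
    inferInstanceAs (Module.Finite ℂ PUnit)⟩

instance : finDimRep.IsClosedUnderSubobjects where
  prop_of_mono {A B} f _ hB := by
    have hB' : FiniteDimensional ℂ B := hB
    exact Module.Finite.of_injective (f.hom.restrictScalars ℂ)
      ((ModuleCat.mono_iff_injective f).1 inferInstance)

instance : finDimRep.IsClosedUnderQuotients where
  prop_of_epi f _ hX := by
    have hf := (ModuleCat.epi_iff_range_eq_top f).1 inferInstance
    exact finDimRep_of_maps f f (by rw [hf, sup_idem]) hX hX

instance : finDimRep.IsClosedUnderFiniteProducts :=
  isClosedUnderFiniteProducts_of_biprod _ fun A B hA hB =>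
    finDimRep_of_maps biprod.inl biprod.inr (range_inl_sup_range_inr A B) hA hB

end FinDim

/-- A `ℂ`-linear abelian category `C` is wild if there is an exact (`ℂ`-linear) functor to `C` from
the category of finite-dimensional representations of `ℂ⟨x₁, x₂⟩` that preserves
indecomposability and takes non-isomorphic objects to non-isomorphic objects. -/
def IsWild (C : Type u) [Category.{v} C] [Abelian C] [Linear ℂ C] : Prop :=
  ∃ (F : finDimRep.FullSubcategory ⥤ C) (_ : F.Additive),
    F.Linear ℂ ∧ exactFunctor _ _ F ∧
    (∀ V, Indecomposable V → Indecomposable (F.obj V)) ∧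
    (∀ V W, ¬ Nonempty (V ≅ W) → ¬ Nonempty (F.obj V ≅ F.obj W))

end VectorFields

end

/-! The proof builds an exact, fully faithful `ℂ`-linear functor from representations of `ℂ⟨x₁, x₂⟩`
to the block; full faithfulness gives preservation of indecomposability and of non-isomorphism.

For a weight `μ`, the delta functions at the origin form the module `V[∂]`, on which `f∂` acts by
`f∂ + μf'`; over `sl₂ = span {d₋₁, d₀, d₁}` it is a Verma module of highest weight `μ - 1` tensored
with `V`. For every `μ` there are cocycles from weight `μ` to weight `μ + k`, `k = 2, 3, 4`,
vanishing on `sl₂` (`cocycle_commutator`). Take weights `c, c+1, c+2` on top and `c+3, c+4, c+5`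
below. The available cocycles join top vertex `a` to bottom vertex `b` whenever `|a - b| ≤ 1`: seven
arrows on six vertices. Five of them form a spanning tree and carry the identity of `V`; the other
two, `0 → 1` and `2 → 1`, carry `x₁` and `x₂`.

The main point is fullness (`DeltaExt.exists_eq_map`). Over `sl₂` the extension splits. If `Re c >
3`, no two of the six Verma modules have nonzero maps between them, so a morphism is given by six
linear maps `V → W`. Commuting with `d₂ = x³∂` means commuting with the seven arrows: the tree makes
the six maps equal, and the other two arrows make the common map linear over `ℂ⟨x₁, x₂⟩`. Since only
`λ + ℤ` matters, `c = λ + n` with `n` large is allowed. -/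

noncomputable section

namespace VectorFields

/-! ### Lie derivatives and cocycles in an algebra with `PQ - QP = 1` -/

section Weyl

variable {R : Type*} [Ring R] [Algebra ℂ R] (P Q : R)

/-- The Lie derivative `f ∂ + μ f'` along `f ∂` on densities of weight `μ`, for `P = ∂`, `Q = x`. -/
def lieDer (μ : ℂ) : ℂ[X] →ₗ[ℂ] R :=
  LinearMap.mulRight ℂ P ∘ₗ (aeval Q).toLinearMap +
    μ • (aeval Q).toLinearMap ∘ₗ derivative

/-- The cocycle of vector fields with values in the differential operators from densities of weight
`μ` to densities of weight `μ + k` that vanishes on `sl₂`; it is `0` unless `k = 2, 3, 4`. -/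
def cocycle (μ : ℂ) : ℕ → ℂ[X] →ₗ[ℂ] R
  | 2 => (aeval Q).toLinearMap ∘ₗ derivative ^ 3
  | 3 => LinearMap.mulRight ℂ P ∘ₗ (aeval Q).toLinearMap ∘ₗ derivative ^ 3
      - (μ / 2) • (aeval Q).toLinearMap ∘ₗ derivative ^ 4
  | 4 => LinearMap.mulRight ℂ (P * P) ∘ₗ (aeval Q).toLinearMap ∘ₗ derivative ^ 3
      - ((2 * μ + 1) / 2) • LinearMap.mulRight ℂ P ∘ₗ (aeval Q).toLinearMap ∘ₗ derivative ^ 4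
      + (μ * (2 * μ + 1) / 10) • (aeval Q).toLinearMap ∘ₗ derivative ^ 5
  | _ => 0

variable {P Q}

theorem mul_aeval_of_commutator (h : P * Q = Q * P + 1) (f : ℂ[X]) :
    P * aeval Q f = aeval Q f * P + aeval Q (derivative f) := by
  induction f using Polynomial.induction_on' with
  | add p q hp hq => simp only [map_add, mul_add, add_mul, hp, hq]; abel
  | monomial n a =>
    induction n with
    | zero => simp [Algebra.commutes]
    | succ n ih =>
      have e : (monomial (n + 1) a : ℂ[X]) = monomial n a * X := by
        rw [monomial_mul_X]
      rw [e, map_mul, aeval_X, ← mul_assoc, ih, derivative_mul, derivative_X, add_mul, map_add,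
        map_mul, mul_one, aeval_X, mul_assoc, h]
      noncomm_ring

theorem lieDer_commutator (h : P * Q = Q * P + 1) (μ : ℂ) (f g : ℂ[X]) :
    lieDer P Q μ f * lieDer P Q μ g - lieDer P Q μ g * lieDer P Q μ f =
      lieDer P Q μ (f * derivative g - derivative f * g) := by
  have hP := mul_aeval_of_commutator h
  have hP' : ∀ (f : ℂ[X]) (z : R), P * (aeval Q f * z) =
      aeval Q f * (P * z) + aeval Q (derivative f) * z := fun f z => by
    rw [← mul_assoc, hP]; noncomm_ring
  -- Normal form: derivatives of `f`, then derivatives of `g`, then powers of `P`.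
  have hc : ∀ i j, aeval Q (derivative^[i] g) * aeval Q (derivative^[j] f) =
      aeval Q (derivative^[j] f) * aeval Q (derivative^[i] g) := fun i j => by
    rw [← map_mul, mul_comm, map_mul]
  have hc' : ∀ i j (z : R), aeval Q (derivative^[i] g) * (aeval Q (derivative^[j] f) * z) =
      aeval Q (derivative^[j] f) * (aeval Q (derivative^[i] g) * z) := fun i j z => by
    rw [← mul_assoc, hc, mul_assoc]
  have h11 := hc 1 1
  have h02 := hc 0 2
  have k00 := hc' 0 0
  have k01 := hc' 0 1
  have k10 := hc' 1 0
  simp only [Function.iterate_succ, Function.iterate_zero, Function.comp_apply, id] at *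
  simp only [lieDer, LinearMap.add_apply, LinearMap.smul_apply, LinearMap.comp_apply,
    LinearMap.mulRight_apply, AlgHom.toLinearMap_apply, mul_add, add_mul, mul_assoc, hP, hP',
    smul_mul_assoc, mul_smul_comm, derivative_mul, map_sub, map_mul, map_add, h11, k00, k01, k10, h02]
  module

/-- `cocycle P Q μ k` is, up to scale, the Rankin–Cohen bracket of order `k - 2` of the quadratic
differential `f'''` with a density of weight `μ`; this explains its coefficients. The identity is
checked by bringing both sides to normal form. -/
theorem cocycle_commutator (h : P * Q = Q * P + 1) (μ : ℂ) (k : ℕ) (f g : ℂ[X]) :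
    (lieDer P Q (μ + k) f * cocycle P Q μ k g + cocycle P Q μ k f * lieDer P Q μ g) -
      (lieDer P Q (μ + k) g * cocycle P Q μ k f + cocycle P Q μ k g * lieDer P Q μ f) =
      cocycle P Q μ k (f * derivative g - derivative f * g) := by
  have hP := mul_aeval_of_commutator h
  have hP' : ∀ (f : ℂ[X]) (z : R), P * (aeval Q f * z) =
      aeval Q f * (P * z) + aeval Q (derivative f) * z := fun f z => by
    rw [← mul_assoc, hP]; noncomm_ring
  have hit : ∀ (n : ℕ) (p : ℂ[X]), (derivative ^ n) p = derivative^[n] p := fun n p => by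
    rw [Module.End.pow_apply]
  have hs : ∀ (n : ℕ) (p : ℂ[X]), derivative (derivative^[n] p) = derivative^[n + 1] p :=
    fun n p => (Function.iterate_succ_apply' _ _ _).symm
  have h1 : ∀ (p : ℂ[X]), derivative p = derivative^[1] p := fun p => rfl
  -- The derivatives of `f` and `g` become opaque symbols `F i`, `G j`, so that rewriting ends with
  -- combinations of words `F i * G j * P ^ l`.
  obtain ⟨F, hF⟩ : ∃ F : ℕ → R, ∀ i, aeval Q (derivative^[i] f) = F i := ⟨_, fun _ => rfl⟩
  obtain ⟨G, hG⟩ : ∃ G : ℕ → R, ∀ i, aeval Q (derivative^[i] g) = G i := ⟨_, fun _ => rfl⟩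
  have hPF : ∀ i, P * F i = F i * P + F (i + 1) := fun i => by rw [← hF, hP, hs, hF]; rw [hF]
  have hPG : ∀ i, P * G i = G i * P + G (i + 1) := fun i => by rw [← hG, hP, hs, hG]; rw [hG]
  have hPF' : ∀ i z, P * (F i * z) = F i * (P * z) + F (i + 1) * z := fun i z => by
    rw [← mul_assoc, hPF]; noncomm_ring
  have hPG' : ∀ i z, P * (G i * z) = G i * (P * z) + G (i + 1) * z := fun i z => by
    rw [← mul_assoc, hPG]; noncomm_ring
  have hc : ∀ i j, G i * F j = F j * G i := fun i j => by
    rw [← hF, ← hG, ← map_mul, mul_comm, map_mul]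
  have hc' : ∀ i j (z : R), G i * (F j * z) = F j * (G i * z) := fun i j z => by
    rw [← mul_assoc, hc, mul_assoc]
  have hF0 := hF 0
  have hG0 := hG 0
  simp only [Function.iterate_zero, id] at hF0 hG0
  have hb : ∀ n, aeval Q (derivative^[n] (f * derivative g - derivative f * g)) =
      ∑ i ∈ Finset.range (n + 1), (n.choose i : ℂ) • (F (n - i) * G (i + 1) -
        F (n - i + 1) * G i) := fun n => by
    rw [iterate_derivative_sub, iterate_derivative_mul, iterate_derivative_mul, map_sub, map_sum,
      map_sum, ← Finset.sum_sub_distrib]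
    refine Finset.sum_congr rfl fun i _ => ?_
    simp only [← Function.iterate_succ_apply, ← hF, ← hG, map_mul, map_nsmul,
      Nat.cast_smul_eq_nsmul ℂ, smul_sub]
  match k with
  | 2 | 3 | 4 =>
    simp only [lieDer, cocycle, LinearMap.add_apply, LinearMap.sub_apply, LinearMap.smul_apply,
      LinearMap.comp_apply, LinearMap.mulRight_apply, AlgHom.toLinearMap_apply, hit, hb]
    simp only [h1, hF, hG, hF0, hG0, mul_add, add_mul, mul_sub, sub_mul, mul_assoc, hPF, hPF', hPG,
      hPG', hc, hc', smul_mul_assoc, mul_smul_comm, Finset.sum_range_succ, Finset.sum_range_zero,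
      Nat.choose, Nat.reduceAdd, Nat.reduceSub, smul_add, smul_sub, zero_mul]
    push_cast
    module
  | 0 | 1 | k + 5 => simp [cocycle]

end Weyl

/-! ### Delta functions at the origin -/

section Delta

variable (V : Type*) [AddCommGroup V] [Module ℂ V]

/-- The action of `∂` on `V[∂] = ℕ →₀ V`. -/
def deltaP : Module.End ℂ (ℕ →₀ V) := Finsupp.lmapDomain V ℂ Nat.succ

/-- The action of `x = -d/d∂` on `V[∂] = ℕ →₀ V`. -/
def deltaQ : Module.End ℂ (ℕ →₀ V) :=
  Finsupp.lsum ℂ fun k : ℕ => (-(k : ℂ)) • Finsupp.lsingle (k - 1)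

variable {V}

@[simp] theorem deltaP_single (k : ℕ) (v : V) :
    deltaP V (Finsupp.single k v) = Finsupp.single (k + 1) v := by
  simp [deltaP, Finsupp.mapDomain_single]

@[simp] theorem deltaQ_single (k : ℕ) (v : V) :
    deltaQ V (Finsupp.single k v) = (-(k : ℂ)) • Finsupp.single (k - 1) v := by
  simp [deltaQ]

variable (V) in
theorem deltaP_mul_deltaQ : deltaP V * deltaQ V = deltaQ V * deltaP V + 1 := by
  refine Finsupp.lhom_ext fun k v => ?_
  rw [LinearMap.add_apply, Module.End.mul_apply, Module.End.mul_apply, deltaQ_single, map_smul,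
    deltaP_single, deltaP_single, deltaQ_single, Module.End.one_apply]
  rcases k with _ | k
  · simp
  · simp only [Nat.add_sub_cancel]
    push_cast
    module

variable {W : Type*} [AddCommGroup W] [Module ℂ W] (φ : V →ₗ[ℂ] W)

/-- The map `V[∂] → W[∂]` induced by a linear map `V → W`. -/
abbrev deltaMap : (ℕ →₀ V) →ₗ[ℂ] (ℕ →₀ W) := Finsupp.mapRange.linearMap φ

theorem deltaMap_deltaP (m : ℕ →₀ V) : deltaMap φ (deltaP V m) = deltaP W (deltaMap φ m) := by
  have : deltaMap φ ∘ₗ deltaP V = deltaP W ∘ₗ deltaMap φ :=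
    Finsupp.lhom_ext fun k v => by simp
  exact LinearMap.congr_fun this m

theorem deltaMap_deltaQ (m : ℕ →₀ V) : deltaMap φ (deltaQ V m) = deltaQ W (deltaMap φ m) := by
  have : deltaMap φ ∘ₗ deltaQ V = deltaQ W ∘ₗ deltaMap φ :=
    Finsupp.lhom_ext fun k v => by
      simp only [LinearMap.comp_apply, deltaQ_single, map_smul, Finsupp.mapRange.linearMap_apply,
        Finsupp.mapRange_single]
  exact LinearMap.congr_fun this m

theorem deltaMap_aeval (f : ℂ[X]) (m : ℕ →₀ V) :
    deltaMap φ (aeval (deltaQ V) f m) = aeval (deltaQ W) f (deltaMap φ m) := by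
  induction f using Polynomial.induction_on' generalizing m with
  | add p q hp hq => rw [map_add, map_add, LinearMap.add_apply, LinearMap.add_apply, map_add, hp, hq]
  | monomial n a =>
    simp only [aeval_monomial, Module.algebraMap_end_eq_smul_id, smul_mul_assoc,
      LinearMap.smul_apply, map_smul, Module.End.mul_apply, LinearMap.id_apply]
    congr 1
    induction n generalizing m with
    | zero => rfl
    | succ n ih => rw [pow_succ, pow_succ, Module.End.mul_apply, ih, deltaMap_deltaQ]; rfl

/-- The action of the vector field `f ∂` on the delta function densities of weight `μ`. -/
abbrev deltaLie (μ : ℂ) : ℂ[X] →ₗ[ℂ] Module.End ℂ (ℕ →₀ V) := lieDer (deltaP V) (deltaQ V) μ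

abbrev deltaCocycle (μ : ℂ) (k : ℕ) : ℂ[X] →ₗ[ℂ] Module.End ℂ (ℕ →₀ V) :=
  cocycle (deltaP V) (deltaQ V) μ k

theorem deltaMap_lie (μ : ℂ) (f : ℂ[X]) (m : ℕ →₀ V) :
    deltaMap φ (deltaLie μ f m) = deltaLie μ f (deltaMap φ m) := by
  simp only [lieDer, LinearMap.add_apply, LinearMap.smul_apply, LinearMap.comp_apply,
    LinearMap.mulRight_apply, AlgHom.toLinearMap_apply, Module.End.mul_apply, map_add, map_smul,
    deltaMap_aeval, deltaMap_deltaP]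

theorem deltaMap_cocycle (μ : ℂ) (k : ℕ) (f : ℂ[X]) (m : ℕ →₀ V) :
    deltaMap φ (deltaCocycle μ k f m) = deltaCocycle μ k f (deltaMap φ m) := by
  match k with
  | 0 | 1 | k + 5 => simp [cocycle]
  | 2 | 3 | 4 =>
    simp only [cocycle, LinearMap.add_apply, LinearMap.sub_apply, LinearMap.smul_apply,
      LinearMap.comp_apply, LinearMap.mulRight_apply, AlgHom.toLinearMap_apply,
      Module.End.mul_apply, map_add, map_sub, map_smul, deltaMap_aeval, deltaMap_deltaP]

theorem exists_deltaMap_eq (φ : V →ₗ[ℂ] W) {q : ℕ →₀ W} (hq : ∀ k, ∃ v, φ v = q k) :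
    ∃ p, deltaMap φ p = q := by
  classical
  choose v hv using hq
  -- The chosen preimage of `0` need not be `0`, so it is replaced by `0` to keep the support
  -- finite.
  refine ⟨Finsupp.onFinset q.support (fun k => if q k = 0 then 0 else v k) fun k hk => ?_, ?_⟩
  · rw [Finsupp.mem_support_iff]
    exact fun h => hk (if_pos h)
  · ext k
    simp only [Finsupp.mapRange.linearMap_apply, Finsupp.mapRange_apply, Finsupp.onFinset_apply]
    split_ifs with h
    · rw [LinearMap.map_zero, h]
    · exact hv k

end Delta

/-! ### The extension and its action of vector fields -/

section Extension

/-- The images of the arrows of the quiver `0, 1, 2 ⇉ 3, 4, 5` in `ℂ⟨x₁, x₂⟩`. -/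
def arrow : Fin 3 → Fin 3 → FreeAlg :=
  ![![1, FreeAlgebra.ι ℂ 0, 0], ![1, 1, 1], ![0, FreeAlgebra.ι ℂ 1, 1]]

/-- The extension of three copies of delta function densities with values in `V`, of weights
`c, c + 1, c + 2`, by three copies of weights `c + 3, c + 4, c + 5`. -/
@[nolint unusedArguments]
def DeltaExt (_ : ℂ) (V : Type*) [AddCommGroup V] : Type _ :=
  (Fin 3 → ℕ →₀ V) × (Fin 3 → ℕ →₀ V)

variable (c : ℂ) (V : Type*) [AddCommGroup V]

instance : AddCommGroup (DeltaExt c V) :=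
  inferInstanceAs (AddCommGroup ((Fin 3 → ℕ →₀ V) × (Fin 3 → ℕ →₀ V)))

variable {c V}

@[ext]
theorem DeltaExt.ext {m m' : DeltaExt c V} (h₁ : ∀ a, m.1 a = m'.1 a) (h₂ : ∀ b, m.2 b = m'.2 b) :
    m = m' :=
  Prod.ext (funext h₁) (funext h₂)

theorem DeltaExt.ext_coeff {m m' : DeltaExt c V} (h₁ : ∀ a k, m.1 a k = m'.1 a k)
    (h₂ : ∀ b k, m.2 b k = m'.2 b k) : m = m' :=
  DeltaExt.ext (fun a => Finsupp.ext (h₁ a)) fun b => Finsupp.ext (h₂ b)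

@[simp] theorem DeltaExt.add_fst (m m' : DeltaExt c V) (a : Fin 3) :
    (m + m').1 a = m.1 a + m'.1 a := rfl
@[simp] theorem DeltaExt.add_snd (m m' : DeltaExt c V) (a : Fin 3) :
    (m + m').2 a = m.2 a + m'.2 a := rfl
@[simp] theorem DeltaExt.sub_fst (m m' : DeltaExt c V) (a : Fin 3) :
    (m - m').1 a = m.1 a - m'.1 a := rfl
@[simp] theorem DeltaExt.sub_snd (m m' : DeltaExt c V) (a : Fin 3) :
    (m - m').2 a = m.2 a - m'.2 a := rfl

variable [Module ℂ V]

instance : Module ℂ (DeltaExt c V) :=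
  inferInstanceAs (Module ℂ ((Fin 3 → ℕ →₀ V) × (Fin 3 → ℕ →₀ V)))

@[simp] theorem DeltaExt.smul_fst (z : ℂ) (m : DeltaExt c V) (a : Fin 3) :
    (z • m).1 a = z • m.1 a := rfl
@[simp] theorem DeltaExt.smul_snd (z : ℂ) (m : DeltaExt c V) (a : Fin 3) :
    (z • m).2 a = z • m.2 a := rfl

variable (c V) [Module FreeAlg V] [IsScalarTower ℂ FreeAlg V]

attribute [local instance] LieRing.ofAssociativeRing

/-- The action of `f ∂` on the extension. -/
def extAction (f : ℂ[X]) : Module.End ℂ (DeltaExt c V) :=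
  LinearMap.prod
    (LinearMap.pi fun a => deltaLie (c + (a : ℕ)) f ∘ₗ LinearMap.proj a ∘ₗ LinearMap.fst ℂ _ _)
    (LinearMap.pi fun b => deltaLie (c + 3 + (b : ℕ)) f ∘ₗ LinearMap.proj b ∘ₗ LinearMap.snd ℂ _ _ +
      ∑ a : Fin 3, deltaCocycle (c + (a : ℕ)) (3 + b - a) f ∘ₗ
        deltaMap (Algebra.lsmul ℂ ℂ V (arrow a b)) ∘ₗ LinearMap.proj a ∘ₗ LinearMap.fst ℂ _ _)

variable {c V}

theorem extAction_fst (f : ℂ[X]) (m : DeltaExt c V) (a : Fin 3) :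
    (extAction c V f m).1 a = deltaLie (c + (a : ℕ)) f (m.1 a) := rfl

theorem extAction_snd (f : ℂ[X]) (m : DeltaExt c V) (b : Fin 3) :
    (extAction c V f m).2 b = deltaLie (c + 3 + (b : ℕ)) f (m.2 b) +
      ∑ a : Fin 3, deltaCocycle (c + (a : ℕ)) (3 + b - a) f
        (deltaMap (Algebra.lsmul ℂ ℂ V (arrow a b)) (m.1 a)) :=
  congrArg (deltaLie (c + 3 + (b : ℕ)) f (m.2 b) + ·) (LinearMap.sum_apply _ _ m)

/-- The action is block triangular. The diagonal blocks are Lie derivatives; the off-diagonal ones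
are cocycles composed with maps induced from `V`, which commute with Lie derivatives. -/
theorem extAction_commutator (f g : ℂ[X]) :
    extAction c V f * extAction c V g - extAction c V g * extAction c V f =
      extAction c V (f * derivative g - derivative f * g) := by
  have hL := fun μ => lieDer_commutator (deltaP_mul_deltaQ V) μ f g
  have hC := fun μ k => cocycle_commutator (deltaP_mul_deltaQ V) μ k f g
  refine LinearMap.ext fun m => DeltaExt.ext (fun a => ?_) fun b => ?_
  · have := LinearMap.congr_fun (hL (c + (a : ℕ))) (m.1 a)
    simpa only [LinearMap.sub_apply, Module.End.mul_apply, DeltaExt.sub_fst, extAction_fst]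
  · have h1 := LinearMap.congr_fun (hL (c + 3 + (b : ℕ))) (m.2 b)
    have h2 := fun a : Fin 3 => LinearMap.congr_fun (hC (c + (a : ℕ)) (3 + b - a))
      (deltaMap (Algebra.lsmul ℂ ℂ V (arrow a b)) (m.1 a))
    have e : ∀ a : Fin 3, c + (a : ℕ) + (3 + b - a : ℕ) = c + 3 + (b : ℕ) := fun a => by
      rw [Nat.cast_sub (by omega)]
      push_cast
      ring
    simp only [e, LinearMap.sub_apply, LinearMap.add_apply, Module.End.mul_apply] at h1 h2
    simp only [LinearMap.sub_apply, Module.End.mul_apply, DeltaExt.sub_snd, extAction_snd,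
      extAction_fst, ← h1, ← h2, deltaMap_lie, map_add, map_sum, Finset.sum_sub_distrib,
      Finset.sum_add_distrib]
    abel

variable (c V) in
/-- The Witt algebra acts on the extension. -/
def extLieHom : WittAlgebra →ₗ⁅ℂ⁆ Module.End ℂ (DeltaExt c V) where
  toFun D := extAction c V (D X)
  map_add' D E := by
    refine LinearMap.ext fun m => DeltaExt.ext (fun a => ?_) fun b => ?_
    · simp [extAction_fst]
    · simp only [Derivation.add_apply, map_add, extAction_snd, LinearMap.add_apply,
        DeltaExt.add_snd, Finset.sum_add_distrib]
      abel
  map_smul' z D := by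
    refine LinearMap.ext fun m => DeltaExt.ext (fun a => ?_) fun b => ?_
    · simp [extAction_fst]
    · simp only [Derivation.smul_apply, map_smul, extAction_snd, LinearMap.smul_apply,
        DeltaExt.smul_snd, Finset.smul_sum, smul_add, RingHom.id_apply]
  map_lie' {D E} := by
    -- A derivation is `(D X) d/dx`, so the bracket of derivations becomes `fg' - f'g`.
    have h : ∀ (D : WittAlgebra) (p : ℂ[X]), D p = derivative p * D X := fun D p => by
      have : D = mkDerivation ℂ (D X) := Polynomial.derivation_ext (by simp)
      rw [this, mkDerivation_apply]
      simp
    change extAction c V (⁅D, E⁆ X) = _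
    rw [LieRing.of_associative_ring_bracket, extAction_commutator, Derivation.commutator_apply,
      h D (E X), h E (D X), mul_comm (derivative (E X))]

/-- The underlying space does not depend on `c`, but this structure does; hence the otherwise idle
argument of `DeltaExt`. -/
instance : Module UW (DeltaExt c V) :=
  Module.compHom _ (UniversalEnvelopingAlgebra.lift ℂ (extLieHom c V)).toRingHom

theorem uw_smul_def (u : UW) (m : DeltaExt c V) :
    u • m = UniversalEnvelopingAlgebra.lift ℂ (extLieHom c V) u m := rfl

instance : IsScalarTower ℂ UW (DeltaExt c V) where
  smul_assoc z u m := by rw [uw_smul_def, map_smul]; rfl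

theorem uvf_smul (n : ℕ) (m : DeltaExt c V) : uvf n • m = extAction c V (X ^ n) m := by
  rw [uw_smul_def, uvf, UniversalEnvelopingAlgebra.lift_ι_apply]
  change extAction c V (vf n X) m = _
  simp [vf]

end Extension

/-! ### Explicit action on coefficients, highest weight vectors and degree -/

section DeltaCoefficients

variable {V : Type*} [AddCommGroup V] [Module ℂ V]

theorem deltaP_apply_succ (p : ℕ →₀ V) (k : ℕ) : deltaP V p (k + 1) = p k := by
  induction p using Finsupp.induction_linear with
  | zero => simp
  | add p q hp hq => simp [hp, hq]
  | single j v => simp [Finsupp.single_apply]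

theorem deltaQ_apply (p : ℕ →₀ V) (k : ℕ) : deltaQ V p k = (-((k : ℂ) + 1)) • p (k + 1) := by
  induction p using Finsupp.induction_linear with
  | zero => simp
  | add p q hp hq => simp only [map_add, Finsupp.add_apply, hp, hq, smul_add]
  | single j v =>
    rw [deltaQ_single]
    rcases j with _ | j
    · simp
    · by_cases h : j = k
      · subst h; simp
      · simp [h]

theorem deltaLie_one (μ : ℂ) (p : ℕ →₀ V) : deltaLie μ 1 p = deltaP V p := by
  simp [lieDer]

theorem deltaLie_X_apply (μ : ℂ) (p : ℕ →₀ V) (k : ℕ) :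
    deltaLie μ X p k = (μ - (k + 1)) • p k := by
  simp only [lieDer, LinearMap.add_apply, LinearMap.smul_apply, LinearMap.comp_apply,
    LinearMap.mulRight_apply, AlgHom.toLinearMap_apply, aeval_X, derivative_X, map_one,
    Module.End.mul_apply, Finsupp.add_apply, deltaQ_apply, deltaP_apply_succ, Finsupp.smul_apply,
    Module.End.one_apply]
  module

theorem deltaLie_X_single (μ : ℂ) (k : ℕ) (v : V) :
    deltaLie μ X (Finsupp.single k v) = (μ - (k + 1)) • Finsupp.single k v := by
  ext j
  rw [deltaLie_X_apply, Finsupp.smul_apply]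
  by_cases h : k = j
  · rw [h]
  · simp [h]

theorem deltaLie_X_sq_apply (μ : ℂ) (p : ℕ →₀ V) (k : ℕ) :
    deltaLie μ (X ^ 2) p k = ((k + 1) * (k + 2 - 2 * μ)) • p (k + 1) := by
  have hd : derivative (X * X : ℂ[X]) = C 2 * X := by
    rw [derivative_mul, derivative_X, map_ofNat]
    ring
  simp only [lieDer, LinearMap.add_apply, LinearMap.smul_apply, LinearMap.comp_apply,
    LinearMap.mulRight_apply, AlgHom.toLinearMap_apply, hd, map_mul, aeval_X, pow_two, aeval_C,
    Module.algebraMap_end_apply, Module.End.mul_apply, Finsupp.add_apply, deltaQ_apply,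
    deltaP_apply_succ, Finsupp.smul_apply]
  push_cast
  module

theorem deltaLie_X_cube_single (μ : ℂ) (v : V) :
    deltaLie μ (X ^ 3) (Finsupp.single 0 v) = 0 := by
  simp [lieDer, pow_succ]

/-- Applied to `1`, `x`, `x²`, this splits the extension over `sl₂`. -/
theorem deltaCocycle_eq_zero (μ : ℂ) (k : ℕ) {f : ℂ[X]} (hf : derivative (derivative (derivative f)) = 0)
    (p : ℕ →₀ V) : deltaCocycle μ k f p = 0 := by
  match k with
  | 0 | 1 | k + 5 => simp [cocycle]
  | 2 | 3 | 4 => simp [cocycle, pow_succ', hf, -iterate_map_zero]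

/-- The third derivative of `x³` is the constant `6`, so only the leading term of the cocycle
survives. Its value is nonzero for every `μ`, which lets `x³∂` alone detect each arrow. -/
theorem deltaCocycle_X_cube_single (μ : ℂ) {k : ℕ} (hk : k = 2 ∨ k = 3 ∨ k = 4) (v : V) :
    deltaCocycle μ k (X ^ 3) (Finsupp.single 0 v) = Finsupp.single (k - 2) ((6 : ℂ) • v) := by
  have h3 : (derivative ^ 3 : ℂ[X] →ₗ[ℂ] ℂ[X]) (X ^ 3) = C 6 := by
    have h6 : (C 6 : ℂ[X]) = 6 := map_ofNat C 6
    simp only [pow_succ', pow_zero, Module.End.mul_apply, derivative_mul,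
      derivative_X, mul_one, one_mul, derivative_add, derivative_one, h6, add_zero]
    norm_num
  have h4 : (derivative ^ 4 : ℂ[X] →ₗ[ℂ] ℂ[X]) (X ^ 3) = 0 := by
    rw [pow_succ', Module.End.mul_apply, h3, derivative_C]
  have h5 : (derivative ^ 5 : ℂ[X] →ₗ[ℂ] ℂ[X]) (X ^ 3) = 0 := by
    rw [pow_succ', Module.End.mul_apply, h4, map_zero]
  rcases hk with rfl | rfl | rfl <;>
    simp only [cocycle, LinearMap.add_apply, LinearMap.sub_apply, LinearMap.smul_apply,
      LinearMap.comp_apply, LinearMap.mulRight_apply, AlgHom.toLinearMap_apply,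
      Module.End.mul_apply, h3, h4, h5, map_zero, smul_zero, add_zero, sub_zero,
      aeval_C, Module.algebraMap_end_apply, deltaP_single, Finsupp.smul_single]

/-- A highest weight vector of weight `μ - 1` for `sl₂` in the delta function densities of weight
`ν` is constant in `∂`, and vanishes unless `ν = μ`. -/
theorem eq_single_of_highestWeight {μ ν : ℂ} (hμ : 3 < μ.re) (hν : 3 < ν.re) {p : ℕ →₀ V}
    (h₁ : deltaLie ν X p = (μ - 1) • p) (h₂ : deltaLie ν (X ^ 2) p = 0) :
    p = Finsupp.single 0 (p 0) ∧ (ν ≠ μ → p = 0) := by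
  have h₁' : ∀ k : ℕ, p k = 0 ∨ ν - (k + 1) = μ - 1 := fun k => by
    have := DFunLike.congr_fun h₁ k
    rw [deltaLie_X_apply, Finsupp.smul_apply, ← sub_eq_zero, ← sub_smul, smul_eq_zero,
      sub_eq_zero] at this
    exact this.symm
  have h₂' : ∀ k, p (k + 1) = 0 := fun k => by
    have := DFunLike.congr_fun h₂ k
    rw [deltaLie_X_sq_apply, Finsupp.zero_apply, smul_eq_zero, mul_eq_zero] at this
    rcases this with (h | h) | h
    · exact absurd h (Nat.cast_add_one_ne_zero k)
    -- If `k + 2 = 2ν`, there is a singular vector in degree `k + 1`, of weight `-ν`. Equating this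
    -- with `μ - 1` gives `ν + μ = 1`, impossible for real parts above `3`.
    · refine (h₁' (k + 1)).resolve_right fun h' => ?_
      push_cast at h'
      have e : ν + μ = 1 := by linear_combination -h - h'
      have := congrArg Complex.re e
      rw [Complex.add_re, Complex.one_re] at this
      linarith
    · exact h
  have h0 : p = Finsupp.single 0 (p 0) := by
    ext k
    rcases k with _ | k
    · simp
    · simp [h₂' k]
  refine ⟨h0, fun hne => ?_⟩
  rw [h0, (h₁' 0).resolve_right fun h => hne (by simpa using h), Finsupp.single_zero]

variable (V) in
/-- The elements of `V[∂]` of degree at most `k`. -/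
def deltaLE (k : ℕ) : Submodule ℂ (ℕ →₀ V) := Finsupp.supported V ℂ (Set.Iic k)

theorem mem_deltaLE {k : ℕ} {p : ℕ →₀ V} : p ∈ deltaLE V k ↔ ∀ j, k < j → p j = 0 := by
  simp [deltaLE, Finsupp.mem_supported']

theorem deltaLE_mono {k l : ℕ} (h : k ≤ l) : deltaLE V k ≤ deltaLE V l :=
  Finsupp.supported_mono (Set.Iic_subset_Iic.2 h)

theorem deltaP_mem_deltaLE {k : ℕ} {p : ℕ →₀ V} (hp : p ∈ deltaLE V k) :
    deltaP V p ∈ deltaLE V (k + 1) := by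
  rw [mem_deltaLE] at hp ⊢
  intro j hj
  obtain ⟨j, rfl⟩ := Nat.exists_eq_succ_of_ne_zero (by omega : j ≠ 0)
  rw [Nat.succ_eq_add_one, deltaP_apply_succ]
  exact hp j (by omega)

theorem deltaQ_mem_deltaLE {k : ℕ} {p : ℕ →₀ V} (hp : p ∈ deltaLE V (k + 1)) :
    deltaQ V p ∈ deltaLE V k := by
  rw [mem_deltaLE] at hp ⊢
  intro j hj
  rw [deltaQ_apply, hp _ (by omega), smul_zero]

theorem aeval_mem_deltaLE {k : ℕ} (f : ℂ[X]) {p : ℕ →₀ V} (hp : p ∈ deltaLE V k) :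
    aeval (deltaQ V) f p ∈ deltaLE V k := by
  induction f using Polynomial.induction_on' with
  | add f g hf hg => rw [map_add]; exact add_mem hf hg
  | monomial n a =>
    rw [aeval_monomial, Module.End.mul_apply, Module.algebraMap_end_apply]
    refine Submodule.smul_mem _ _ ?_
    induction n with
    | zero => exact hp
    | succ n ih =>
      rw [pow_succ', Module.End.mul_apply]
      exact deltaQ_mem_deltaLE (deltaLE_mono k.le_succ ih)

/-- The single factor `∂` raises the degree by one, and one of the factors `x` lowers it back. -/
theorem deltaLie_mem_deltaLE (μ : ℂ) (n : ℕ) {k : ℕ} {p : ℕ →₀ V} (hp : p ∈ deltaLE V k) :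
    deltaLie μ (X ^ (n + 2)) p ∈ deltaLE V k := by
  refine add_mem ?_ (Submodule.smul_mem _ _ (aeval_mem_deltaLE _ hp))
  have : aeval (deltaQ V) ((X : ℂ[X]) ^ (n + 2)) (deltaP V p) =
      aeval (deltaQ V) ((X : ℂ[X]) ^ (n + 1)) (deltaQ V (deltaP V p)) := by
    rw [pow_succ _ (n + 1), map_mul, aeval_X]
    rfl
  exact this ▸ aeval_mem_deltaLE _ (deltaQ_mem_deltaLE (deltaP_mem_deltaLE hp))

theorem deltaCocycle_mem_deltaLE (μ : ℂ) (n : ℕ) (f : ℂ[X]) {k : ℕ} {p : ℕ →₀ V}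
    (hp : p ∈ deltaLE V k) : deltaCocycle μ n f p ∈ deltaLE V (k + 2) := by
  have h0 : ∀ f : ℂ[X], aeval (deltaQ V) f p ∈ deltaLE V (k + 2) := fun f =>
    aeval_mem_deltaLE f (deltaLE_mono (by omega) hp)
  have h1 : ∀ f : ℂ[X], aeval (deltaQ V) f (deltaP V p) ∈ deltaLE V (k + 2) := fun f =>
    aeval_mem_deltaLE f (deltaLE_mono (by omega) (deltaP_mem_deltaLE hp))
  match n with
  | 0 | 1 | n + 5 => simp [cocycle]
  | 2 => exact h0 _
  | 3 => exact sub_mem (h1 _) (Submodule.smul_mem _ _ (h0 _))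
  | 4 =>
    exact add_mem (sub_mem (aeval_mem_deltaLE _ (deltaP_mem_deltaLE (deltaP_mem_deltaLE hp)))
      (Submodule.smul_mem _ _ (h1 _))) (Submodule.smul_mem _ _ (h0 _))

instance [FiniteDimensional ℂ V] (k : ℕ) : FiniteDimensional ℂ (deltaLE V k) :=
  Module.Finite.equiv (Finsupp.supportedEquivFinsupp (M := V) (R := ℂ) (Set.Iic k)).symm

end DeltaCoefficients

/-! ### The extension lies in category `𝒪` -/

section ExtensionInO

variable {c : ℂ} {V : Type*} [AddCommGroup V] [Module ℂ V]

variable (c V) in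
/-- The inclusion of the densities of weight `c + a`. -/
def extInl (a : Fin 3) : (ℕ →₀ V) →ₗ[ℂ] DeltaExt c V :=
  LinearMap.inl ℂ (Fin 3 → ℕ →₀ V) (Fin 3 → ℕ →₀ V) ∘ₗ LinearMap.single ℂ (fun _ => ℕ →₀ V) a

variable (c V) in
/-- The inclusion of the densities of weight `c + 3 + b`. -/
def extInr (b : Fin 3) : (ℕ →₀ V) →ₗ[ℂ] DeltaExt c V :=
  LinearMap.inr ℂ (Fin 3 → ℕ →₀ V) (Fin 3 → ℕ →₀ V) ∘ₗ LinearMap.single ℂ (fun _ => ℕ →₀ V) b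

@[simp] theorem extInl_fst_self (a : Fin 3) (p : ℕ →₀ V) : (extInl c V a p).1 a = p :=
  Pi.single_eq_same (M := fun _ => ℕ →₀ V) a p
theorem extInl_fst (a a' : Fin 3) (p : ℕ →₀ V) :
    (extInl c V a p).1 a' = if a' = a then p else 0 :=
  Pi.single_apply a p a'
@[simp] theorem extInl_snd (a b : Fin 3) (p : ℕ →₀ V) : (extInl c V a p).2 b = 0 := rfl
@[simp] theorem extInr_fst (a b : Fin 3) (p : ℕ →₀ V) : (extInr c V b p).1 a = 0 := rfl
theorem extInr_snd (b b' : Fin 3) (p : ℕ →₀ V) :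
    (extInr c V b p).2 b' = if b' = b then p else 0 :=
  Pi.single_apply b p b'

theorem eq_sum_extInl_add_sum_extInr (m : DeltaExt c V) :
    m = ∑ a, extInl c V a (m.1 a) + ∑ b, extInr c V b (m.2 b) := by
  refine DeltaExt.ext (fun a => ?_) fun b => ?_
  · fin_cases a <;> simp [Fin.sum_univ_three, extInl_fst]
  · fin_cases b <;> simp [Fin.sum_univ_three, extInr_snd]

theorem eq_top_of_single_mem (S : Submodule ℂ (DeltaExt c V))
    (h₁ : ∀ a k v, extInl c V a (Finsupp.single k v) ∈ S)
    (h₂ : ∀ b k v, extInr c V b (Finsupp.single k v) ∈ S) : S = ⊤ := by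
  have key : ∀ L : (ℕ →₀ V) →ₗ[ℂ] DeltaExt c V, (∀ k v, L (Finsupp.single k v) ∈ S) →
      ∀ p, L p ∈ S := fun L hL p => by
    induction p using Finsupp.induction_linear with
    | zero => rw [map_zero]; exact zero_mem _
    | add p q hp hq => rw [map_add]; exact add_mem hp hq
    | single k v => exact hL k v
  rw [eq_top_iff]
  intro m _
  rw [eq_sum_extInl_add_sum_extInr m]
  exact add_mem (Submodule.sum_mem _ fun a _ => key _ (h₁ a) _)
    (Submodule.sum_mem _ fun b _ => key _ (h₂ b) _)

variable (c V) in
/-- The elements of the extension of degree at most `k` and `k + 2` respectively. -/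
def extLE (k : ℕ) : Submodule ℂ (DeltaExt c V) :=
  (Submodule.pi Set.univ fun _ : Fin 3 => deltaLE V k).prod
    (Submodule.pi Set.univ fun _ : Fin 3 => deltaLE V (k + 2))

theorem mem_extLE {k : ℕ} {m : DeltaExt c V} : m ∈ extLE c V k ↔
    (∀ a, m.1 a ∈ deltaLE V k) ∧ ∀ b, m.2 b ∈ deltaLE V (k + 2) := by
  refine Submodule.mem_prod.trans (and_congr ?_ ?_) <;> simp only [Submodule.mem_pi, Set.mem_univ,
    forall_const]

instance [FiniteDimensional ℂ V] (k : ℕ) : FiniteDimensional ℂ (extLE c V k) := by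
  let L : extLE c V k →ₗ[ℂ] (Fin 3 → deltaLE V k) × (Fin 3 → deltaLE V (k + 2)) :=
    { toFun := fun m => (fun a => ⟨m.1.1 a, (mem_extLE.1 m.2).1 a⟩,
        fun b => ⟨m.1.2 b, (mem_extLE.1 m.2).2 b⟩)
      map_add' := fun m m' => rfl
      map_smul' := fun z m => rfl }
  refine Module.Finite.of_injective L fun m m' h => Subtype.ext (DeltaExt.ext (fun a => ?_) fun b => ?_)
  · exact congrArg Subtype.val (congrFun (congrArg Prod.fst h) a)
  · exact congrArg Subtype.val (congrFun (congrArg Prod.snd h) b)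

theorem exists_mem_extLE (m : DeltaExt c V) : ∃ k, m ∈ extLE c V k := by
  have h : ∀ p : ℕ →₀ V, ∃ k, p ∈ deltaLE V k := fun p => by
    refine ⟨p.support.sup id, mem_deltaLE.2 fun j hj => ?_⟩
    by_contra hne
    exact hj.not_ge (Finset.le_sup (f := id) (Finsupp.mem_support_iff.2 hne))
  choose k hk using h
  refine ⟨Finset.univ.sup (fun a => k (m.1 a)) ⊔ Finset.univ.sup (fun b => k (m.2 b)),
    mem_extLE.2 ⟨fun a => deltaLE_mono ?_ (hk (m.1 a)), fun b => deltaLE_mono ?_ (hk (m.2 b))⟩⟩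
  · exact le_sup_of_le_left (Finset.le_sup (f := fun a => k (m.1 a)) (Finset.mem_univ a))
  · exact Nat.le_add_right_of_le
      (le_sup_of_le_right (Finset.le_sup (f := fun b => k (m.2 b)) (Finset.mem_univ b)))

variable [Module FreeAlg V] [IsScalarTower ℂ FreeAlg V]

theorem extAction_extInr (f : ℂ[X]) (b : Fin 3) (p : ℕ →₀ V) :
    extAction c V f (extInr c V b p) = extInr c V b (deltaLie (c + 3 + (b : ℕ)) f p) := by
  refine DeltaExt.ext (fun a => ?_) fun b' => ?_
  · simp [extAction_fst]
  · rw [extAction_snd, extInr_snd, extInr_snd]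
    split_ifs with h <;> simp [h]

theorem extAction_extInl (f : ℂ[X]) (hf : derivative (derivative (derivative f)) = 0) (a : Fin 3)
    (p : ℕ →₀ V) :
    extAction c V f (extInl c V a p) = extInl c V a (deltaLie (c + (a : ℕ)) f p) := by
  refine DeltaExt.ext (fun a' => ?_) fun b => ?_
  · rw [extAction_fst, extInl_fst, extInl_fst]
    split_ifs with h <;> simp [h]
  · simp [extAction_snd, deltaCocycle_eq_zero _ _ hf]

/-- The cocycles contain at most two factors `∂`; the shift by `2` in `extLE` absorbs them. -/
theorem extAction_mem_extLE (n : ℕ) {k : ℕ} {m : DeltaExt c V} (hm : m ∈ extLE c V k) :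
    extAction c V (X ^ (n + 2)) m ∈ extLE c V k := by
  rw [mem_extLE] at hm ⊢
  refine ⟨fun a => deltaLie_mem_deltaLE _ _ (hm.1 a), fun b => ?_⟩
  rw [extAction_snd]
  refine add_mem (deltaLie_mem_deltaLE _ _ (hm.2 b)) (Submodule.sum_mem _ fun a _ => ?_)
  refine deltaCocycle_mem_deltaLE _ _ _ (mem_deltaLE.2 fun j hj => ?_)
  have := mem_deltaLE.1 (hm.1 a) j hj
  simp [this]

theorem UWplus_smul_mem_extLE {u : UW} (hu : u ∈ UWplus) {k : ℕ} :
    ∀ m ∈ extLE c V k, u • m ∈ extLE c V k := by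
  induction hu using Algebra.adjoin_induction with
  | mem x hx =>
    obtain ⟨n, rfl⟩ := hx
    intro m hm
    rw [uvf_smul]
    exact extAction_mem_extLE n hm
  | algebraMap r => intro x hx; rw [algebraMap_smul]; exact Submodule.smul_mem _ r hx
  | add a b _ _ ha hb => intro x hx; rw [add_smul]; exact add_mem (ha x hx) (hb x hx)
  | mul a b _ _ ha hb => intro x hx; rw [mul_smul]; exact ha _ (hb x hx)

theorem uvf_zero_smul_extInl (a : Fin 3) (p : ℕ →₀ V) :
    uvf 0 • extInl c V a p = extInl c V a (deltaP V p) := by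
  rw [uvf_smul, pow_zero, extAction_extInl _ (by simp), deltaLie_one]

theorem uvf_zero_smul_extInr (b : Fin 3) (p : ℕ →₀ V) :
    uvf 0 • extInr c V b p = extInr c V b (deltaP V p) := by
  rw [uvf_smul, pow_zero, extAction_extInr, deltaLie_one]

theorem extInl_single_mem_weightSpace (a : Fin 3) (k : ℕ) (v : V) :
    extInl c V a (Finsupp.single k v) ∈ weightSpace (DeltaExt c V) (c + (a : ℕ) - (k + 1)) := by
  rw [mem_weightSpace, uvf_smul, pow_one, extAction_extInl _ (by simp), deltaLie_X_single, map_smul]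

theorem extInr_single_mem_weightSpace (b : Fin 3) (k : ℕ) (v : V) :
    extInr c V b (Finsupp.single k v) ∈ weightSpace (DeltaExt c V) (c + 3 + (b : ℕ) - (k + 1)) := by
  rw [mem_weightSpace, uvf_smul, pow_one, extAction_extInr, deltaLie_X_single, map_smul]

-- The subspaces `extLE c V k` are finite-dimensional, stable under `U(W⁺)` and exhaust the module,
-- which gives local finiteness. As `d₋₁` acts by `∂` on each summand, `extLE c V 0` generates.
variable (c V) in
theorem isInO_deltaExt [FiniteDimensional ℂ V] : IsInO (DeltaExt c V) where
  fg := by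
    obtain ⟨B, hB⟩ := (Submodule.fg_iff_finiteDimensional (extLE c V 0)).2 inferInstance
    have hle : extLE c V 0 ≤ (Submodule.span UW (B : Set (DeltaExt c V))).restrictScalars ℂ := by
      rw [← hB, Submodule.span_le]
      exact Submodule.subset_span
    refine ⟨⟨B, ?_⟩⟩
    rw [← Submodule.restrictScalars_eq_top_iff ℂ]
    refine eq_top_of_single_mem _ (fun a k v => ?_) fun b k v => ?_
    · induction k with
      | zero =>
        refine hle (mem_extLE.2 ⟨fun a' => ?_, fun b => by simp⟩)
        rw [extInl_fst]
        split_ifs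
        · exact Finsupp.single_mem_supported ℂ v (Set.mem_Iic.2 le_rfl)
        · exact zero_mem _
      | succ k ih =>
        rw [← deltaP_single, ← uvf_zero_smul_extInl]
        exact Submodule.smul_mem _ (uvf 0) ih
    · induction k with
      | zero =>
        refine hle (mem_extLE.2 ⟨fun a => by simp, fun b' => ?_⟩)
        rw [extInr_snd]
        split_ifs
        · exact Finsupp.single_mem_supported ℂ v (Set.mem_Iic.2 (Nat.zero_le _))
        · exact zero_mem _
      | succ k ih =>
        rw [← deltaP_single, ← uvf_zero_smul_extInr]
        exact Submodule.smul_mem _ (uvf 0) ih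
  weight := eq_top_of_single_mem _
    (fun a k v => Submodule.mem_iSup_of_mem _ (extInl_single_mem_weightSpace a k v))
    (fun b k v => Submodule.mem_iSup_of_mem _ (extInr_single_mem_weightSpace b k v))
  locallyFinite m := by
    obtain ⟨k, hk⟩ := exists_mem_extLE m
    refine Submodule.finiteDimensional_of_le (S₂ := extLE c V k) fun x hx => ?_
    obtain ⟨u, hu, rfl⟩ := mem_orbitPlus.1 hx
    exact UWplus_smul_mem_extLE hu m hk

theorem supp_deltaExt {μ : ℂ} (hμ : μ ∈ Supp (DeltaExt c V)) : ∃ n : ℤ, μ = c + n := by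
  by_contra! hcon
  -- The monomials are weight vectors with weights in `c + ℤ`, so weight spaces other than that of
  -- `μ` already span; independence then kills the latter.
  have htop : ⨆ ν, ⨆ (_ : ν ≠ μ), weightSpace (DeltaExt c V) ν = ⊤ := by
    refine eq_top_of_single_mem _ (fun a k v => ?_) fun b k v => ?_
    · refine Submodule.mem_iSup_of_mem _ (Submodule.mem_iSup_of_mem (fun h => ?_)
        (extInl_single_mem_weightSpace a k v))
      refine hcon ((a : ℕ) - (k + 1)) ?_
      rw [← h]; push_cast; ring
    · refine Submodule.mem_iSup_of_mem _ (Submodule.mem_iSup_of_mem (fun h => ?_)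
        (extInr_single_mem_weightSpace b k v))
      refine hcon (3 + (b : ℕ) - (k + 1)) ?_
      rw [← h]; push_cast; ring
  have hind := weightSpace_iSupIndep (M := DeltaExt c V) μ
  rw [htop, disjoint_top] at hind
  exact hμ hind

end ExtensionInO

/-! ### Functoriality and exactness in `V` -/

section Map

theorem map_uw_smul_of_map_uvf_smul {M N : Type*} [AddCommGroup M] [Module ℂ M] [Module UW M]
    [IsScalarTower ℂ UW M] [AddCommGroup N] [Module ℂ N] [Module UW N] [IsScalarTower ℂ UW N]
    (T : M →ₗ[ℂ] N) (h : ∀ n m, T (uvf n • m) = uvf n • T m) (u : UW) :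
    ∀ m, T (u • m) = u • T m := by
  have hu : u ∈ Algebra.adjoin ℂ (Set.range uvf) := adjoin_uvf ▸ Algebra.mem_top
  induction hu using Algebra.adjoin_induction with
  | mem x hx => obtain ⟨n, rfl⟩ := hx; exact h n
  | algebraMap r => intro m; rw [algebraMap_smul, algebraMap_smul, map_smul]
  | add a b _ _ ha hb => intro m; rw [add_smul, add_smul, map_add, ha, hb]
  | mul a b _ _ ha hb => intro m; rw [mul_smul, mul_smul, ha, hb]

variable (c : ℂ) {V W : Type*} [AddCommGroup V] [Module ℂ V] [Module FreeAlg V]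
  [IsScalarTower ℂ FreeAlg V] [AddCommGroup W] [Module ℂ W] [Module FreeAlg W]
  [IsScalarTower ℂ FreeAlg W]

/-- The morphism of extensions induced by a morphism of representations of `ℂ⟨x₁, x₂⟩`. -/
def DeltaExt.map (φ : V →ₗ[FreeAlg] W) : DeltaExt c V →ₗ[UW] DeltaExt c W :=
  let T : DeltaExt c V →ₗ[ℂ] DeltaExt c W :=
    LinearMap.prodMap (LinearMap.piMap fun _ : Fin 3 => deltaMap (φ.restrictScalars ℂ))
      (LinearMap.piMap fun _ : Fin 3 => deltaMap (φ.restrictScalars ℂ))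
  { T with
    map_smul' := map_uw_smul_of_map_uvf_smul T fun n m => by
      have hT₁ : ∀ m a, (T m).1 a = deltaMap (φ.restrictScalars ℂ) (m.1 a) := fun _ _ => rfl
      have hT₂ : ∀ m b, (T m).2 b = deltaMap (φ.restrictScalars ℂ) (m.2 b) := fun _ _ => rfl
      -- Only here is linearity over `ℂ⟨x₁, x₂⟩` needed: `φ` must commute with the arrows.
      have hφ : ∀ (r : FreeAlg) (p : ℕ →₀ V), deltaMap (φ.restrictScalars ℂ)
          (deltaMap (Algebra.lsmul ℂ ℂ V r) p) =
            deltaMap (Algebra.lsmul ℂ ℂ W r) (deltaMap (φ.restrictScalars ℂ) p) := fun r p => by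
        ext k
        simp
      rw [uvf_smul, uvf_smul]
      refine DeltaExt.ext (fun a => ?_) fun b => ?_
      · rw [hT₁, extAction_fst, extAction_fst, hT₁, deltaMap_lie]
      · rw [hT₂, extAction_snd, extAction_snd, hT₂, map_add, deltaMap_lie, map_sum]
        congr 1
        refine Finset.sum_congr rfl fun a _ => ?_
        rw [deltaMap_cocycle, hφ, hT₁] }

variable {c}

@[simp] theorem DeltaExt.map_fst (φ : V →ₗ[FreeAlg] W) (m : DeltaExt c V) (a : Fin 3) (k : ℕ) :
    (DeltaExt.map c φ m).1 a k = φ (m.1 a k) := rfl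

variable {U : Type*} [AddCommGroup U] [Module ℂ U] [Module FreeAlg U] [IsScalarTower ℂ FreeAlg U]

protected theorem DeltaExt.map_id : DeltaExt.map c (LinearMap.id : V →ₗ[FreeAlg] V) = LinearMap.id :=
  LinearMap.ext fun _ => DeltaExt.ext_coeff (fun _ _ => rfl) fun _ _ => rfl

protected theorem DeltaExt.map_comp (ψ : V →ₗ[FreeAlg] W) (φ : U →ₗ[FreeAlg] V) :
    DeltaExt.map c (ψ ∘ₗ φ) = DeltaExt.map c ψ ∘ₗ DeltaExt.map c φ :=
  LinearMap.ext fun _ => DeltaExt.ext_coeff (fun _ _ => rfl) fun _ _ => rfl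

protected theorem DeltaExt.map_add (φ ψ : V →ₗ[FreeAlg] W) :
    DeltaExt.map c (φ + ψ) = DeltaExt.map c φ + DeltaExt.map c ψ :=
  LinearMap.ext fun _ => DeltaExt.ext_coeff (fun _ _ => rfl) fun _ _ => rfl

theorem DeltaExt.map_apply_of_smul {φ ψ : V →ₗ[FreeAlg] W} {z : ℂ} (h : ∀ v, ψ v = z • φ v)
    (m : DeltaExt c V) : DeltaExt.map c ψ m = z • DeltaExt.map c φ m :=
  DeltaExt.ext_coeff (fun _ _ => h _) fun _ _ => h _

theorem DeltaExt.mem_range_map (φ : V →ₗ[FreeAlg] W) {m : DeltaExt c W}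
    (h₁ : ∀ a k, ∃ v, φ v = m.1 a k) (h₂ : ∀ b k, ∃ v, φ v = m.2 b k) :
    ∃ m', DeltaExt.map c φ m' = m := by
  choose p hp using fun a => exists_deltaMap_eq (φ.restrictScalars ℂ) (h₁ a)
  choose q hq using fun b => exists_deltaMap_eq (φ.restrictScalars ℂ) (h₂ b)
  exact ⟨(p, q), DeltaExt.ext hp hq⟩

theorem DeltaExt.map_surjective {φ : V →ₗ[FreeAlg] W} (hφ : Function.Surjective φ) :
    Function.Surjective (DeltaExt.map c φ) := fun _ =>
  DeltaExt.mem_range_map φ (fun _ _ => hφ _) fun _ _ => hφ _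

theorem DeltaExt.map_apply_injective {φ : V →ₗ[FreeAlg] W} (hφ : Function.Injective φ) :
    Function.Injective (DeltaExt.map c φ) := fun _ _ h =>
  DeltaExt.ext_coeff (fun a k => hφ (congrArg (fun m : DeltaExt c W => m.1 a k) h))
    fun b k => hφ (congrArg (fun m : DeltaExt c W => m.2 b k) h)

theorem DeltaExt.map_exact {φ : U →ₗ[FreeAlg] V} {ψ : V →ₗ[FreeAlg] W}
    (h : Function.Exact φ ψ) : Function.Exact (DeltaExt.map c φ) (DeltaExt.map c ψ) := by
  refine fun m => ⟨fun hm => ?_, ?_⟩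
  · exact DeltaExt.mem_range_map φ
      (fun a k => (h _).1 (congrArg (fun m : DeltaExt c W => m.1 a k) hm))
      fun b k => (h _).1 (congrArg (fun m : DeltaExt c W => m.2 b k) hm)
  · rintro ⟨m, rfl⟩
    exact DeltaExt.ext_coeff (fun _ _ => h.apply_apply_eq_zero _)
      fun _ _ => h.apply_apply_eq_zero _

/-! ### Fullness through `sl₂` highest weight vectors -/

theorem eq_of_highestWeight {μ : ℂ} (hc : 3 < c.re) (hμ : 3 < μ.re) {m : DeltaExt c V}
    (h₁ : uvf 1 • m = (μ - 1) • m) (h₂ : uvf 2 • m = 0) :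
    (∀ a, m.1 a = Finsupp.single 0 (m.1 a 0) ∧ (c + (a : ℕ) ≠ μ → m.1 a = 0)) ∧
      ∀ b, m.2 b = Finsupp.single 0 (m.2 b 0) ∧ (c + 3 + (b : ℕ) ≠ μ → m.2 b = 0) := by
  rw [uvf_smul, pow_one] at h₁
  rw [uvf_smul] at h₂
  refine ⟨fun a => eq_single_of_highestWeight hμ ?_ ?_ ?_,
    fun b => eq_single_of_highestWeight hμ ?_ ?_ ?_⟩
  · have := (a : ℕ).cast_nonneg (α := ℝ)
    simp only [Complex.add_re, Complex.natCast_re]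
    linarith
  · exact congrArg (fun m : DeltaExt c V => m.1 a) h₁
  · exact congrArg (fun m : DeltaExt c V => m.1 a) h₂
  · have := (b : ℕ).cast_nonneg (α := ℝ)
    simp only [Complex.add_re, Complex.natCast_re, Complex.re_ofNat]
    linarith
  · have := congrArg (fun m : DeltaExt c V => m.2 b) h₁
    beta_reduce at this
    rw [extAction_snd, Finset.sum_eq_zero fun a _ => deltaCocycle_eq_zero _ _ (by simp) _,
      add_zero] at this
    exact this
  · have := congrArg (fun m : DeltaExt c V => m.2 b) h₂
    beta_reduce at this
    rw [extAction_snd, Finset.sum_eq_zero fun a _ => deltaCocycle_eq_zero _ _ (by simp) _,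
      add_zero] at this
    exact this

/-- Degree zero generates `V[∂]` under `∂`, which is the action of `d₋₁`. -/
theorem linearMap_apply_eq_of_single_zero (Φ : DeltaExt c V →ₗ[UW] DeltaExt c W)
    {L : (ℕ →₀ V) →ₗ[ℂ] DeltaExt c V} {L' : (ℕ →₀ W) →ₗ[ℂ] DeltaExt c W}
    (hL : ∀ p, uvf 0 • L p = L (deltaP V p)) (hL' : ∀ p, uvf 0 • L' p = L' (deltaP W p))
    {φ : V →ₗ[ℂ] W} (h : ∀ v, Φ (L (Finsupp.single 0 v)) = L' (Finsupp.single 0 (φ v)))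
    (p : ℕ →₀ V) : Φ (L p) = L' (deltaMap φ p) := by
  have : Φ.restrictScalars ℂ ∘ₗ L = L' ∘ₗ deltaMap φ := Finsupp.lhom_ext fun k v => by
    change Φ (L (Finsupp.single k v)) = L' (deltaMap φ (Finsupp.single k v))
    induction k with
    | zero => simpa using h v
    | succ k ih =>
      rw [← deltaP_single, ← hL, map_smul, ih, hL', deltaMap_deltaP]
  exact LinearMap.congr_fun this p

/-- The image of a degree-zero vector is again a highest weight vector of weight `c + a - 1`. The
six weights `c, …, c + 5` being distinct, it can only sit in degree zero of the same summand. -/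
theorem exists_linearMap_apply_extInl (hc : 3 < c.re) (Φ : DeltaExt c V →ₗ[UW] DeltaExt c W)
    (a : Fin 3) : ∃ φ : V →ₗ[ℂ] W, ∀ p, Φ (extInl c V a p) = extInl c W a (deltaMap φ p) := by
  let φ : V →ₗ[ℂ] W := Finsupp.lapply 0 ∘ₗ LinearMap.proj a ∘ₗ
    LinearMap.fst ℂ (Fin 3 → ℕ →₀ W) (Fin 3 → ℕ →₀ W) ∘ₗ
      (Φ.restrictScalars ℂ ∘ₗ extInl c V a ∘ₗ Finsupp.lsingle 0 : V →ₗ[ℂ] DeltaExt c W)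
  refine ⟨φ, linearMap_apply_eq_of_single_zero Φ (uvf_zero_smul_extInl a)
    (uvf_zero_smul_extInl a) fun v => ?_⟩
  have h := eq_of_highestWeight (μ := c + (a : ℕ)) (m := Φ (extInl c V a (Finsupp.single 0 v))) hc
    (by
      have := (a : ℕ).cast_nonneg (α := ℝ)
      simp only [Complex.add_re, Complex.natCast_re]
      linarith)
    (by
      rw [← map_smul, uvf_smul, pow_one, extAction_extInl _ (by simp), deltaLie_X_single, map_smul,
        Φ.map_smul_of_tower]
      norm_num)
    (by
      rw [← map_smul, uvf_smul, extAction_extInl _ (by simp)]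
      convert map_zero Φ
      convert map_zero (extInl c V a)
      ext k
      simp [deltaLie_X_sq_apply])
  refine DeltaExt.ext (fun a' => ?_) fun b => ?_
  · rw [extInl_fst]
    split_ifs with e
    · rw [e]
      exact (h.1 a).1
    · refine (h.1 a').2 fun h' => e (Fin.ext ?_)
      exact_mod_cast add_left_cancel h'
  · refine (h.2 b).2 fun h' => ?_
    have : 3 + (b : ℕ) = a := by
      rw [add_assoc] at h'
      exact_mod_cast add_left_cancel h'
    omega

theorem exists_linearMap_apply_extInr (hc : 3 < c.re) (Φ : DeltaExt c V →ₗ[UW] DeltaExt c W)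
    (b : Fin 3) : ∃ φ : V →ₗ[ℂ] W, ∀ p, Φ (extInr c V b p) = extInr c W b (deltaMap φ p) := by
  let φ : V →ₗ[ℂ] W := Finsupp.lapply 0 ∘ₗ LinearMap.proj b ∘ₗ
    LinearMap.snd ℂ (Fin 3 → ℕ →₀ W) (Fin 3 → ℕ →₀ W) ∘ₗ
      (Φ.restrictScalars ℂ ∘ₗ extInr c V b ∘ₗ Finsupp.lsingle 0 : V →ₗ[ℂ] DeltaExt c W)
  refine ⟨φ, linearMap_apply_eq_of_single_zero Φ (uvf_zero_smul_extInr b)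
    (uvf_zero_smul_extInr b) fun v => ?_⟩
  have h := eq_of_highestWeight (μ := c + 3 + (b : ℕ))
    (m := Φ (extInr c V b (Finsupp.single 0 v))) hc
    (by
      have := (b : ℕ).cast_nonneg (α := ℝ)
      simp only [Complex.add_re, Complex.natCast_re, Complex.re_ofNat]
      linarith)
    (by
      rw [← map_smul, uvf_smul, pow_one, extAction_extInr, deltaLie_X_single, map_smul,
        Φ.map_smul_of_tower]
      norm_num)
    (by
      rw [← map_smul, uvf_smul, extAction_extInr]
      convert map_zero Φ
      convert map_zero (extInr c V b)
      ext k
      simp [deltaLie_X_sq_apply])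
  refine DeltaExt.ext (fun a => ?_) fun b' => ?_
  · refine (h.1 a).2 fun h' => ?_
    have : (a : ℕ) = 3 + b := by
      rw [add_assoc] at h'
      exact_mod_cast add_left_cancel h'
    omega
  · rw [extInr_snd]
    split_ifs with e
    · rw [e]
      exact (h.2 b).1
    · refine (h.2 b').2 fun h' => e (Fin.ext ?_)
      exact_mod_cast add_left_cancel h'

theorem uvf_three_smul_extInl_snd {a b : Fin 3}
    (hab : 3 + (b : ℕ) - a = 2 ∨ 3 + (b : ℕ) - a = 3 ∨ 3 + (b : ℕ) - a = 4) (v : V) :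
    (uvf 3 • extInl c V a (Finsupp.single 0 v)).2 b =
      Finsupp.single (3 + (b : ℕ) - a - 2) ((6 : ℂ) • arrow a b • v) := by
  rw [uvf_smul, extAction_snd, extInl_snd, map_zero, zero_add, Finset.sum_eq_single a]
  · rw [extInl_fst_self, Finsupp.mapRange.linearMap_apply, Finsupp.mapRange_single,
      deltaCocycle_X_cube_single _ hab]
    rfl
  · intro a' _ ha'
    rw [extInl_fst, if_neg ha', map_zero, map_zero]
  · simp

/-- `DeltaExt.map` is full. -/
theorem DeltaExt.exists_eq_map (hc : 3 < c.re) (Φ : DeltaExt c V →ₗ[UW] DeltaExt c W) :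
    ∃ φ : V →ₗ[FreeAlg] W, Φ = DeltaExt.map c φ := by
  choose φ hφ using exists_linearMap_apply_extInl hc Φ
  choose ψ hψ using exists_linearMap_apply_extInr hc Φ
  have hsnd : ∀ m b, (∀ a, m.1 a = 0) → (Φ m).2 b = deltaMap (ψ b) (m.2 b) := fun m b hm => by
    conv_lhs => rw [eq_sum_extInl_add_sum_extInr m]
    simp only [hm, map_zero, Finset.sum_const_zero, zero_add, map_sum, hψ]
    fin_cases b <;> simp [Fin.sum_univ_three, extInr_snd]
  -- On degree-zero vectors of the top, `x³∂` acts through the cocycles alone, so comparing the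
  -- components at `b` of `Φ (x³∂ v) = x³∂ (Φ v)` isolates one arrow.
  have harrow : ∀ a b : Fin 3, (3 + (b : ℕ) - a = 2 ∨ 3 + (b : ℕ) - a = 3 ∨ 3 + (b : ℕ) - a = 4) →
      ∀ v, ψ b (arrow a b • v) = arrow a b • φ a v := fun a b hab v => by
    have h := map_smul Φ (uvf 3) (extInl c V a (Finsupp.single 0 v))
    have h' := hsnd (uvf 3 • extInl c V a (Finsupp.single 0 v)) b fun a' => by
      rw [uvf_smul, extAction_fst, extInl_fst]
      split_ifs
      · exact deltaLie_X_cube_single _ _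
      · exact map_zero _
    rw [h, hφ, Finsupp.mapRange.linearMap_apply, Finsupp.mapRange_single, uvf_three_smul_extInl_snd hab,
      uvf_three_smul_extInl_snd hab,
      Finsupp.mapRange.linearMap_apply, Finsupp.mapRange_single] at h'
    have := Finsupp.single_injective _ h'
    rw [map_smul] at this
    exact (smul_right_injective W (by norm_num : (6 : ℂ) ≠ 0) this).symm
  -- The five identity arrows form a spanning tree, so all six maps coincide.
  have h00 : ψ 0 = φ 0 := LinearMap.ext fun v => by simpa [arrow] using harrow 0 0 (by simp) v
  have h10 : ψ 0 = φ 1 := LinearMap.ext fun v => by simpa [arrow] using harrow 1 0 (by simp) v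
  have h11 : ψ 1 = φ 1 := LinearMap.ext fun v => by simpa [arrow] using harrow 1 1 (by simp) v
  have h12 : ψ 2 = φ 1 := LinearMap.ext fun v => by simpa [arrow] using harrow 1 2 (by simp) v
  have h22 : ψ 2 = φ 2 := LinearMap.ext fun v => by simpa [arrow] using harrow 2 2 (by simp) v
  have hφ1 : ∀ a, φ a = φ 1 := fun a => by
    fin_cases a
    · exact h00.symm.trans h10
    · rfl
    · exact h22.symm.trans h12
  have hψ1 : ∀ b, ψ b = φ 1 := fun b => by
    fin_cases b
    · exact h10
    · exact h11
    · exact h12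
  -- The two remaining arrows give compatibility with the generators.
  have hx : ∀ (i : Fin 2) v, φ 1 (FreeAlgebra.ι ℂ i • v) = FreeAlgebra.ι ℂ i • φ 1 v := fun i v => by
    fin_cases i
    · simpa [arrow, hφ1, hψ1] using harrow 0 1 (by simp) v
    · simpa [arrow, hφ1, hψ1] using harrow 2 1 (by simp) v
  have hlin : ∀ (r : FreeAlg) v, φ 1 (r • v) = r • φ 1 v := fun r => by
    induction r using FreeAlgebra.induction with
    | grade0 z => intro v; rw [algebraMap_smul, algebraMap_smul, map_smul]
    | grade1 i => exact hx i
    | mul r s hr hs => intro v; rw [mul_smul, mul_smul, hr, hs]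
    | add r s hr hs => intro v; rw [add_smul, add_smul, map_add, hr, hs]
  refine ⟨{ φ 1 with map_smul' := hlin }, LinearMap.ext fun m => ?_⟩
  conv_lhs => rw [eq_sum_extInl_add_sum_extInr m]
  rw [map_add, map_sum, map_sum]
  simp only [hφ, hψ, hφ1, hψ1]
  refine DeltaExt.ext (fun a => ?_) fun b => ?_
  · fin_cases a <;> simp [Fin.sum_univ_three, extInl_fst] <;> rfl
  · fin_cases b <;> simp [Fin.sum_univ_three, extInr_snd] <;> rfl

theorem DeltaExt.map_injective {φ ψ : V →ₗ[FreeAlg] W} (h : DeltaExt.map c φ = DeltaExt.map c ψ) :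
    φ = ψ := by
  ext v
  have := congrArg (fun m : DeltaExt c W => m.1 0 0)
    (LinearMap.congr_fun h (extInl c V 0 (Finsupp.single 0 v)))
  simpa using this

end Map

/-! ### Fully faithful functors preserve indecomposability -/

section Indecomposability

universe v₁ v₂ u₁ u₂

/-- A decomposition of `F.obj V` gives complementary orthogonal idempotents, which lift to `V` and
split there because `C` is abelian. The image of `F` need not be closed under summands. -/
theorem indecomposable_obj_of_fullyFaithful {C : Type u₁} [Category.{v₁} C] [Abelian C]
    {D : Type u₂} [Category.{v₂} D] [Abelian D] (F : C ⥤ D) [F.Additive] [F.Full] [F.Faithful]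
    {V : C} (hV : Indecomposable V) : Indecomposable (F.obj V) := by
  refine ⟨fun h => hV.1 ?_, fun Y Z i => ?_⟩
  · rw [IsZero.iff_id_eq_zero] at h ⊢
    exact F.map_injective (by rw [F.map_id, h, F.map_zero])
  · let e₁ : V ⟶ V := F.preimage (i.hom ≫ biprod.fst ≫ biprod.inl ≫ i.inv)
    let e₂ : V ⟶ V := F.preimage (i.hom ≫ biprod.snd ≫ biprod.inr ≫ i.inv)
    have h₁ : e₁ ≫ e₁ = e₁ := F.map_injective (by simp [e₁])
    have h₂ : e₂ ≫ e₂ = e₂ := F.map_injective (by simp [e₂])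
    have h₁₂ : e₁ ≫ e₂ = 0 := F.map_injective (by simp [e₁, e₂])
    have h₂₁ : e₂ ≫ e₁ = 0 := F.map_injective (by simp [e₁, e₂])
    have hadd : e₁ + e₂ = 𝟙 V := F.map_injective (by
      have := congrArg (fun f => i.hom ≫ f ≫ i.inv) (biprod.total (X := Y) (Y := Z))
      rw [F.map_add, F.map_preimage, F.map_preimage, F.map_id]
      simpa only [Preadditive.add_comp, Preadditive.comp_add, Category.assoc, Category.id_comp,
        Iso.hom_inv_id] using this)
    obtain ⟨A, a, p, hap, hpa⟩ := IsIdempotentComplete.idempotents_split V e₁ h₁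
    obtain ⟨B, b, q, hbq, hqb⟩ := IsIdempotentComplete.idempotents_split V e₂ h₂
    -- Inserting the identities `a ≫ p` and `b ≫ q` produces the factor `e₁ ≫ e₂ = 0`.
    have haq : a ≫ q = 0 := by
      calc a ≫ q = (a ≫ p) ≫ (a ≫ q) ≫ (b ≫ q) := by rw [hap, hbq]; simp
        _ = a ≫ ((p ≫ a) ≫ (q ≫ b)) ≫ q := by simp only [Category.assoc]
        _ = 0 := by rw [hpa, hqb, h₁₂, Limits.zero_comp, Limits.comp_zero]
    have hbp : b ≫ p = 0 := by
      calc b ≫ p = (b ≫ q) ≫ (b ≫ p) ≫ (a ≫ p) := by rw [hap, hbq]; simp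
        _ = b ≫ ((q ≫ b) ≫ (p ≫ a)) ≫ p := by simp only [Category.assoc]
        _ = 0 := by rw [hpa, hqb, h₂₁, Limits.zero_comp, Limits.comp_zero]
    let S : BinaryBicone A B := ⟨V, p, q, a, b, hap, haq, hbp, hbq⟩
    have hS : S.IsBilimit := isBinaryBilimitOfTotal S (by
      change p ≫ a + q ≫ b = 𝟙 V
      rw [hpa, hqb, hadd])
    refine (hV.2 A B (biprod.uniqueUpToIso A B hS)).imp (fun hA => ?_) fun hB => ?_
    -- If `A` is zero, so is `e₁`; but `F.map e₁` is the projection to `Y`, and it restricts to the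
    -- identity of `Y`.
    · have h0 : F.map e₁ = 0 := by rw [← hpa, hA.eq_of_tgt p 0, Limits.zero_comp, F.map_zero]
      rw [IsZero.iff_id_eq_zero]
      have := congrArg (fun f => (biprod.inl ≫ i.inv) ≫ f ≫ i.hom ≫ biprod.fst) h0
      simpa [e₁] using this
    · have h0 : F.map e₂ = 0 := by rw [← hqb, hB.eq_of_tgt q 0, Limits.zero_comp, F.map_zero]
      rw [IsZero.iff_id_eq_zero]
      have := congrArg (fun f => (biprod.inr ≫ i.inv) ≫ f ≫ i.hom ≫ biprod.snd) h0
      simpa [e₂] using this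

theorem preservesHomology_ι {C : Type u₁} [Category.{v₁} C] [Abelian C] (P : ObjectProperty C)
    [P.ContainsZero] [P.IsClosedUnderKernels] [P.IsClosedUnderCokernels]
    [P.IsClosedUnderFiniteProducts] : P.ι.PreservesHomology where
  preservesKernels _ _ f := P.preservesKernels_ι f
  preservesCokernels _ _ f := P.preservesCokernels_ι f

end Indecomposability

/-! ### The functor into the block -/

section Functor

/-- `blockO` reads the `ℂ`-structure that an object of `ModuleCat` inherits from `U(W)`; the scalar
tower identifies it with the given one on `M`. -/
theorem blockO_of {lam : ℂ} {M : Type} [AddCommGroup M] [i : Module ℂ M] [Module UW M]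
    [s : IsScalarTower ℂ UW M] (h : IsInO M) (h' : ∀ μ ∈ Supp M, ∃ n : ℤ, μ = lam + n) :
    blockO lam (ModuleCat.of UW M) := by
  have e : i = ModuleCat.moduleOfAlgebraModule (ModuleCat.of UW M) :=
    Module.ext' _ _ fun z m => (algebraMap_smul UW z m).symm
  subst e
  exact ⟨h, h'⟩

theorem blockO_deltaExt (lam : ℂ) (n : ℕ) (V : Type) [AddCommGroup V] [Module ℂ V]
    [Module FreeAlg V] [IsScalarTower ℂ FreeAlg V] [FiniteDimensional ℂ V] :
    blockO lam (ModuleCat.of UW (DeltaExt (lam + n) V)) := by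
  refine blockO_of (isInO_deltaExt _ V) fun μ hμ => ?_
  obtain ⟨k, rfl⟩ := supp_deltaExt hμ
  exact ⟨n + k, by push_cast; ring⟩

instance (V : finDimRep.FullSubcategory) : FiniteDimensional ℂ V.obj := V.property

/-- The functor that sends a representation `V` of `ℂ⟨x₁, x₂⟩` to the `W`-module
`DeltaExt (lam + n) V`. -/
def deltaExtFunctor (lam : ℂ) (n : ℕ) :
    finDimRep.FullSubcategory ⥤ (blockO lam).FullSubcategory where
  obj V := ⟨ModuleCat.of UW (DeltaExt (lam + n) V.obj), blockO_deltaExt lam n V.obj⟩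
  map f := ObjectProperty.homMk (ModuleCat.ofHom (DeltaExt.map (lam + n) f.hom.hom))
  map_id _ := InducedCategory.hom_ext (ModuleCat.hom_ext DeltaExt.map_id)
  map_comp f g := InducedCategory.hom_ext
    (ModuleCat.hom_ext (DeltaExt.map_comp g.hom.hom f.hom.hom))

variable (lam : ℂ) (n : ℕ)

instance : (deltaExtFunctor lam n).Additive where
  map_add {_ _ f g} :=
    InducedCategory.hom_ext (ModuleCat.hom_ext (DeltaExt.map_add f.hom.hom g.hom.hom))

instance : (deltaExtFunctor lam n).Linear ℂ where
  map_smul {V W} f z := by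
    refine InducedCategory.hom_ext (ModuleCat.hom_ext (LinearMap.ext fun m => ?_))
    refine (DeltaExt.map_apply_of_smul (φ := f.hom.hom) (fun _ => rfl) m).trans ?_
    exact (algebraMap_smul UW z (DeltaExt.map (lam + n) f.hom.hom m)).symm

instance : (deltaExtFunctor lam n).Faithful where
  map_injective {V W f g} h := by
    refine InducedCategory.hom_ext (ModuleCat.hom_ext (DeltaExt.map_injective (c := lam + n) ?_))
    exact congrArg (fun k => k.hom.hom) h

theorem deltaExtFunctor_full (h : 3 < (lam + n).re) : (deltaExtFunctor lam n).Full where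
  map_surjective {V W} Φ := by
    obtain ⟨φ, hφ⟩ := DeltaExt.exists_eq_map h (V := V.obj) (W := W.obj) Φ.hom.hom
    exact ⟨ObjectProperty.homMk (ModuleCat.ofHom φ),
      InducedCategory.hom_ext (ModuleCat.hom_ext hφ.symm)⟩

theorem shortExact_map_deltaExtFunctor_ι (S : ShortComplex finDimRep.FullSubcategory)
    (hS : S.ShortExact) : (S.map (deltaExtFunctor lam n ⋙ (blockO lam).ι)).ShortExact := by
  have := preservesHomology_ι finDimRep
  have hι : ∀ S : ShortComplex finDimRep.FullSubcategory,
      S.ShortExact → (S.map finDimRep.ι).ShortExact :=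
    (Functor.exact_tfae finDimRep.ι).out 0 2 |>.2 this
  have h := hι S hS
  have hex := (ShortComplex.ShortExact.moduleCat_exact_iff_function_exact _).1 h.exact
  have hf : Mono ((deltaExtFunctor lam n).map S.f).hom := (ModuleCat.mono_iff_injective _).2
    (DeltaExt.map_apply_injective h.moduleCat_injective_f)
  have hg : Epi ((deltaExtFunctor lam n).map S.g).hom := (ModuleCat.epi_iff_surjective _).2
    (DeltaExt.map_surjective h.moduleCat_surjective_g)
  exact { exact := (ShortComplex.ShortExact.moduleCat_exact_iff_function_exact _).2
            (DeltaExt.map_exact hex)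
          mono_f := hf
          epi_g := hg }

/-- Exactness is tested coefficientwise among all `U(W)`-modules; the inclusion of the block, being
fully faithful, reflects limits and colimits. -/
theorem exactFunctor_deltaExtFunctor : exactFunctor _ _ (deltaExtFunctor lam n) := by
  obtain ⟨h₁, h₂⟩ := (Functor.exact_tfae (deltaExtFunctor lam n ⋙ (blockO lam).ι)).out 0 3 |>.1
    (shortExact_map_deltaExtFunctor_ι lam n)
  rw [exactFunctor_iff]
  constructor
  · constructor
    intro J _ _
    exact preservesLimitsOfShape_of_reflects_of_preserves (deltaExtFunctor lam n) (blockO lam).ι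
  · constructor
    intro J _ _
    exact preservesColimitsOfShape_of_reflects_of_preserves (deltaExtFunctor lam n) (blockO lam).ι

end Functor

end VectorFields

end

theorem mainTheorem4 (lam : ℂ) : VectorFields.IsWild (VectorFields.blockO lam).FullSubcategory := by
  -- The shift by `n` stays in `λ + ℤ` and reaches the range `Re c > 3` where fullness holds.
  obtain ⟨n, hn⟩ := exists_nat_gt (3 - lam.re)
  have hre : 3 < (lam + n).re := by
    rw [Complex.add_re, Complex.natCast_re]
    linarith
  have := VectorFields.deltaExtFunctor_full lam n hre
  refine ⟨VectorFields.deltaExtFunctor lam n, inferInstance, inferInstance,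
    VectorFields.exactFunctor_deltaExtFunctor lam n,
    fun V hV => VectorFields.indecomposable_obj_of_fullyFaithful _ hV, fun V W h h' => h ?_⟩
  exact ⟨(VectorFields.deltaExtFunctor lam n).preimageIso h'.some⟩
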